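/- **Setting.** Let $n\ge 0$ and let $G$ be a set of maps $\mathbb R^n\to\mathbb R^n$ such that: (A1) $G$ is a semigroup under composition; (A2) every $\phi\in G$ is $C^1$ and $\phi-\mathrm{id}$ has compact support; (A3) $f\circ\phi\circ f^{-1}\in G$ for every $\phi\in G$ and every homothety-translation $f(x)=x_1+\varepsilon(x-x_0)$, $\varepsilon>0$. For open $E\subset\mathbb R^n$ let $G(E)$ be the set of $\phi\in G$ such that the support of $\phi-\mathrm{id}$ is a compact subset of $E$. Let $J(G)=\{\nabla\phi(x_0):\phi\in G\}$, a set of matrices which does not depend on $x_0\in\mathbb R^n$. Let $\Omega\subset\mathbb R^n$ be open and bounded. Let $TG(\Omega)$ be the set of all $\eta\in C_0^\infty(\Omega,\mathbb R^n)$ for which there are $a<0<b$ such that the flow $\dot\phi_t=\eta\circ\phi_t$, $\phi_0=\mathrm{id}$, satisfies $\phi_t\in G$ for all $t\in(a,b)$. For $W:\mathbb R^n\times\mathbb R^n\times J(G)\to\mathbb R$ continuous put $I(u;\Omega)=\int_\Omega W(x,u(x),\nabla u(x))\,dx$. We say that $I(\cdot;\Omega)$ is *left continuous at* $u$ (under inner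 variations) if $I(u\circ\phi_h;\Omega)\to I(u;\Omega)$ for every sequence $\phi_h\in G(\Omega)$ converging weakly\* in $W^{1,\infty}(\Omega,\mathbb R^n)$ to $\mathrm{id}$. A homogeneous integrand $W=W(F)$ is said to be a *$G$ left null Lagrangian* if $I(F\phi;\Omega)=I(F;\Omega)$, that is $\int_\Omega W(F\nabla\phi(x))\,dx=\int_\Omega W(F)\,dx$, for all $F\in J(G)$ and $\phi\in G(\Omega)$. **Theorem.** (i) Let $W=W(F)$ be continuous on $J(G)$. If $I(\cdot;\Omega)$ is left continuous at every $\psi\in G$, then $W$ is a $G$ left null Lagrangian. More generally, let $W=W(x,y,F)$ be continuous on $\mathbb R^n\times\mathbb R^n\times J(G)$ and let $u\in C^1(\mathbb R^n,\mathbb R^n)$ with $\nabla u(x)\in J(G)$ for all $x\in\mathbb R^n$. If $I(\cdot;\Omega)$ is left continuous at $u$, then for every $x_0\in\Omega$ the function $W$ is $G$ left invariant at $(x_0,y_0,F)=(x_0,u(x_0),\nabla u(x_0))$, that is, $$\int_E W(x_0,y_0,F\,\nabla\phi(y))\,dy=|E|\,W(x_0,y_0,F)$$ for every bounded open set $E\subset\mathbb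 R^n$ and every $\phi\in G(E)$. (ii) Let $W=W(F)$ be a $C^2$ function defined on an open neighbourhood of $J(G)$. If $W$ is a $G$ left null Lagrangian, then for all $F\in J(G)$ and $\eta\in TG(\Omega)$ the generalized Legendre–Hadamard equality holds (summation over all repeated indices): $$\frac{\partial^2W}{\partial F_{ij}\,\partial F_{mr}}(F)\,F_{ik}\,F_{mp}\int_\Omega\eta_{k,j}\,\eta_{p,r}\,dx=0 .$$ -/

import Mathlib

open MeasureTheory Set Filter Topology
open scoped ContDiff

noncomputable section

namespace InnerVariation

/-- Points of `ℝⁿ`. -/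
abbrev Pt (n : ℕ) := EuclideanSpace ℝ (Fin n)

/-- Real `n × n` matrices (values of gradients), as linear maps of `ℝⁿ`. -/
abbrev Mat (n : ℕ) := Pt n →L[ℝ] Pt n

/-- The standard basis vector `e_j` of `ℝⁿ`. -/
def e {n : ℕ} (j : Fin n) : Pt n := EuclideanSpace.single j 1

/-- The matrix entry `F_ij`. -/
def entry {n : ℕ} (F : Mat n) (i j : Fin n) : ℝ := F (e j) i

/-- The elementary matrix with a `1` in row `i`, column `j` and zeros elsewhere. -/
def elem {n : ℕ} (i j : Fin n) : Mat n :=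
  (EuclideanSpace.proj j : Pt n →L[ℝ] ℝ).smulRight (e i)

theorem entry_elem {n : ℕ} (i j k l : Fin n) :
    entry (elem i j) k l = if k = i ∧ l = j then 1 else 0 := by
  by_cases h1 : k = i <;> by_cases h2 : l = j <;>
    simp [entry, elem, e, h1, h2]

/-- `supp f ⊂⊂ E`: the support of `f` is compact and contained in `E`. -/
def SuppIn {n : ℕ} (f : Pt n → Pt n) (E : Set (Pt n)) : Prop :=
  HasCompactSupport f ∧ tsupport f ⊆ E

/-- The homothety-translation `x ↦ x₁ + ε (x - x₀)`. -/
def homTrans {n : ℕ} (x₀ x₁ : Pt n) (ε : ℝ) : Pt n → Pt n := fun x => x₁ + ε • (x - x₀)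

/-- For `ε ≠ 0` the inverse of a homothety-translation is again one. -/
theorem homTrans_inverse {n : ℕ} (x₀ x₁ : Pt n) {ε : ℝ} (hε : ε ≠ 0) :
    Function.LeftInverse (homTrans x₁ x₀ ε⁻¹) (homTrans x₀ x₁ ε) ∧
      Function.RightInverse (homTrans x₁ x₀ ε⁻¹) (homTrans x₀ x₁ ε) := by
  constructor <;> intro x <;> simp [homTrans, smul_smul, hε]

/-- The axioms on a set `G` of maps `ℝⁿ → ℝⁿ`: it is a semigroup under composition; its elements
are `C¹` and differ from the identity on a relatively compact set only; it is stable under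
conjugation with homothety-translations. -/
structure IsInnerSemigroup {n : ℕ} (G : Set (Pt n → Pt n)) : Prop where
  comp_mem : ∀ φ ∈ G, ∀ ψ ∈ G, φ ∘ ψ ∈ G
  contDiff : ∀ φ ∈ G, ContDiff ℝ 1 φ
  compactSupport : ∀ φ ∈ G, HasCompactSupport (φ - id)
  conj_mem : ∀ φ ∈ G, ∀ (x₀ x₁ : Pt n) (ε : ℝ), 0 < ε →
    homTrans x₀ x₁ ε ∘ φ ∘ homTrans x₁ x₀ ε⁻¹ ∈ G

/-- `G(E)`: the elements of `G` with `supp (φ - id) ⊂⊂ E`. -/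
def localPart {n : ℕ} (G : Set (Pt n → Pt n)) (E : Set (Pt n)) : Set (Pt n → Pt n) :=
  {φ | φ ∈ G ∧ SuppIn (φ - id) E}

/-- The first order jet of `G` at `x₀`. -/
def jetAt {n : ℕ} (G : Set (Pt n → Pt n)) (x₀ : Pt n) : Set (Mat n) :=
  {F | ∃ φ ∈ G, F = fderiv ℝ φ x₀}

/-- `J(G)`: the first order jet of `G`. It does not depend on the base point, see `jetAt_eq`. -/
def jet {n : ℕ} (G : Set (Pt n → Pt n)) : Set (Mat n) := jetAt G 0

theorem jetAt_eq {n : ℕ} {G : Set (Pt n → Pt n)} (hG : IsInnerSemigroup G) (x₀ : Pt n) :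
    jetAt G x₀ = jet G := by
  have key : ∀ a b : Pt n, jetAt G a ⊆ jetAt G b := by
    rintro a b F ⟨φ, hφ, rfl⟩
    refine ⟨_, hG.conj_mem φ hφ a b 1 one_pos, ?_⟩
    have h : homTrans a b 1 ∘ φ ∘ homTrans b a (1 : ℝ)⁻¹
        = fun x => (b - a) + φ (x + (a - b)) := by
      funext x
      have hx : a + (x - b) = x + (a - b) := by abel
      simp only [homTrans, Function.comp, inv_one, one_smul, hx]
      abel
    rw [h, fderiv_const_add, fderiv_comp_add_right]
    congr 1
    abel
  exact Subset.antisymm (key _ _) (key _ _)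

/-- `TG(Ω)`: the vector fields `η ∈ C₀^∞(Ω, ℝⁿ)` whose one parameter flow, defined on some time
interval `(a, b)` around `0`, lies in `G`. -/
def tangent {n : ℕ} (G : Set (Pt n → Pt n)) (Ω : Set (Pt n)) : Set (Pt n → Pt n) :=
  {η | ContDiff ℝ ∞ η ∧ SuppIn η Ω ∧
    ∃ (a b : ℝ) (φ : ℝ → Pt n → Pt n), a < 0 ∧ 0 < b ∧ φ 0 = id ∧
      (∀ t ∈ Ioo a b, ∀ x, HasDerivAt (fun s => φ s x) (η (φ t x)) t) ∧
      ∀ t ∈ Ioo a b, φ t ∈ G}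

/-- Weak* convergence in `W^{1,∞}(Ω, ℝⁿ)` of a sequence of `C¹` maps: all components and all first
derivatives converge when tested against `L¹(Ω)` functions. -/
def WeakStarTendsto {n : ℕ} (Ω : Set (Pt n)) (φ : ℕ → Pt n → Pt n) (ψ : Pt n → Pt n) : Prop :=
  ∀ g : Pt n → ℝ, IntegrableOn g Ω →
    (∀ i : Fin n, Tendsto (fun h => ∫ x in Ω, g x * φ h x i) atTop
      (𝓝 (∫ x in Ω, g x * ψ x i))) ∧
    ∀ i j : Fin n, Tendsto (fun h => ∫ x in Ω, g x * entry (fderiv ℝ (φ h) x) i j) atTop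
      (𝓝 (∫ x in Ω, g x * entry (fderiv ℝ ψ x) i j))

/-- The functional `I(u; Ω) = ∫_Ω W(x, u(x), ∇u(x)) dx`. -/
def energy {n : ℕ} (W : Pt n → Pt n → Mat n → ℝ) (Ω : Set (Pt n)) (u : Pt n → Pt n) : ℝ :=
  ∫ x in Ω, W x (u x) (fderiv ℝ u x)

/-- A homogeneous integrand `W = W(F)`, as an integrand depending on `(x, y, F)`. -/
def homogeneous {n : ℕ} (W : Mat n → ℝ) : Pt n → Pt n → Mat n → ℝ := fun _ _ F => W F

/-- `I(· ; Ω)` is left continuous at `u` (sequentially weak*, under inner variations from `G`). -/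
def LeftContinuousAt {n : ℕ} (G : Set (Pt n → Pt n)) (Ω : Set (Pt n))
    (W : Pt n → Pt n → Mat n → ℝ) (u : Pt n → Pt n) : Prop :=
  ∀ φ : ℕ → Pt n → Pt n, (∀ h, φ h ∈ localPart G Ω) → WeakStarTendsto Ω φ id →
    Tendsto (fun h => energy W Ω (u ∘ φ h)) atTop (𝓝 (energy W Ω u))

/-- `W` is `G` left invariant (both lower and upper invariant) at the triplet `(x₀, y₀, F)`. -/
def LeftInvariantAt {n : ℕ} (G : Set (Pt n → Pt n)) (W : Pt n → Pt n → Mat n → ℝ)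
    (x₀ y₀ : Pt n) (F : Mat n) : Prop :=
  ∀ E : Set (Pt n), IsOpen E → Bornology.IsBounded E → ∀ φ ∈ localPart G E,
    ∫ y in E, W x₀ y₀ (F.comp (fderiv ℝ φ y)) = volume.real E * W x₀ y₀ F

/-- The null Lagrangian identity at left on `Ω`: `I(F φ) = I(F)` for all `F ∈ J(G)` and
`φ ∈ G(Ω)`. -/
def IsLeftNullLagrangian {n : ℕ} (G : Set (Pt n → Pt n)) (Ω : Set (Pt n)) (W : Mat n → ℝ) :
    Prop :=
  ∀ F ∈ jet G, ∀ φ ∈ localPart G Ω,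
    energy (homogeneous W) Ω (F ∘ φ) = energy (homogeneous W) Ω F

/-- The second partial derivative `∂²W / ∂F_ij ∂F_mr` at `F`. -/
def secondPartial {n : ℕ} (W : Mat n → ℝ) (F : Mat n) (i j m r : Fin n) : ℝ :=
  fderiv ℝ (fun A => fderiv ℝ W A (elem m r)) F (elem i j)

end InnerVariation

end

open InnerVariation

/-!
For the necessity of left invariance, let `φ ∈ G(E)` and choose a cube that contains both the
support of `φ - id` and its image under `φ`. A small cube around `x₀` is divided into `N ^ n`
congruent cells, and in each of them a rescaled copy of `φ` is placed. Each copy maps its cell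
into itself, so the composition of all of them acts in every cell by the copy living there
(`exists_glued`), although `φ` need not be injective. As `N → ∞` these maps tend to the identity
weakly* (`weakStarTendsto_glued`), because `∇φ - 1` has mean zero. After freezing `(x, u(x),
∇u(x))` at `x₀`, the change of the energy is, for every `N`, the same positive multiple of `∫
(W(x₀, u(x₀), F ∇φ) - W(x₀, u(x₀), F))`, and freezing costs little if the cube is small. Left
continuity therefore makes this integral vanish (`leftInvariantAt_of_leftContinuousAt`). The claim
on homogeneous integrands is the special case `u ∈ G`, `∇u(x₀) = F`, `E = Ω`.

For the Legendre–Hadamard equality, the flow satisfies `∇φ_t = 1 + t ∇η + O(t²)` uniformly in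
space (`exists_norm_fderiv_flow_sub_le`), it is the identity off the support of `η`, and hence `∫
(∇φ_t - 1) = 0`. In the second order Taylor expansion of `∫ W(F ∇φ_t) = ∫ W(F)` at `F` the linear
term thus drops out, and division by `t²` leaves `∫ D²W(F)[F ∇η, F ∇η] = 0`
(`integral_second_fderiv_eq_zero`), which is then written out in coordinates.
-/

open InnerVariation

namespace InnerVariation

/-! ### Jets and integrals of derivatives -/

theorem fderiv_mem_jet {n : ℕ} {G : Set (Pt n → Pt n)} (hG : IsInnerSemigroup G)
    {φ : Pt n → Pt n} (hφ : φ ∈ G) (x : Pt n) : fderiv ℝ φ x ∈ jet G := by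
  rw [← jetAt_eq hG x]
  exact ⟨φ, hφ, rfl⟩

/-- The chain rule makes `J(G)` a semigroup, because every element of `J(G)` is a gradient at every
prescribed point. -/
theorem jet_comp_mem {n : ℕ} {G : Set (Pt n → Pt n)} (hG : IsInnerSemigroup G)
    {F H : Mat n} (hF : F ∈ jet G) (hH : H ∈ jet G) : F.comp H ∈ jet G := by
  obtain ⟨φ, hφ, rfl⟩ := hH
  rw [← jetAt_eq hG (φ 0)] at hF
  obtain ⟨ψ, hψ, rfl⟩ := hF
  rw [← fderiv_comp 0 (((hG.contDiff ψ hψ).differentiable one_ne_zero) _)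
    (((hG.contDiff φ hφ).differentiable one_ne_zero) _)]
  exact fderiv_mem_jet hG (hG.comp_mem ψ hψ φ hφ) 0

theorem contDiff_sub_id {n : ℕ} {φ : Pt n → Pt n} (hφ : ContDiff ℝ 1 φ) :
    ContDiff ℝ 1 (φ - id) :=
  hφ.sub contDiff_id

theorem fderiv_sub_id {n : ℕ} {φ : Pt n → Pt n} (hφ : ContDiff ℝ 1 φ) (x : Pt n) :
    fderiv ℝ (φ - id) x = fderiv ℝ φ x - ContinuousLinearMap.id ℝ (Pt n) := by
  rw [fderiv_sub (hφ.differentiable one_ne_zero x) differentiableAt_id, fderiv_id]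

theorem fderiv_eq_id_of_notMem_tsupport {n : ℕ} {φ : Pt n → Pt n} (hφ : ContDiff ℝ 1 φ)
    {x : Pt n} (hx : x ∉ tsupport (φ - id)) : fderiv ℝ φ x = ContinuousLinearMap.id ℝ (Pt n) := by
  have h := fderiv_of_notMem_tsupport (𝕜 := ℝ) hx
  rwa [fderiv_sub_id hφ, sub_eq_zero] at h

theorem eq_self_of_notMem_tsupport {n : ℕ} {φ : Pt n → Pt n}
    {x : Pt n} (hx : x ∉ tsupport (φ - id)) : φ x = x := by
  simpa [sub_eq_zero] using image_eq_zero_of_notMem_tsupport hx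

theorem integrable_fderiv_of_hasCompactSupport {n : ℕ} {v : Pt n → Pt n} (hv : ContDiff ℝ 1 v)
    (hc : HasCompactSupport v) : Integrable (fderiv ℝ v) :=
  (hv.continuous_fderiv one_ne_zero).integrable_of_hasCompactSupport (hc.fderiv ℝ)

theorem integral_fderiv_eq_zero {n : ℕ} {v : Pt n → Pt n} (hv : ContDiff ℝ 1 v)
    (hc : HasCompactSupport v) : ∫ x, fderiv ℝ v x = 0 := by
  have hi := integrable_fderiv_of_hasCompactSupport hv hc
  ext1 y
  rw [ContinuousLinearMap.integral_apply hi]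
  have h := integral_smul_fderiv_eq_neg_fderiv_smul_of_integrable (μ := (volume : Measure (Pt n)))
    (f := fun _ => (1 : ℝ)) (g := v) (v := y) (by simp)
    (by simpa using hi.apply_continuousLinearMap y)
    (by simpa using hv.continuous.integrable_of_hasCompactSupport hc)
    (fun x _ => by fun_prop) (fun x _ => hv.differentiable one_ne_zero x)
  simpa using h

/-! ### Sums of rescaled copies -/

/-- The sum over `k` of the copies of `q` moved to the centre `c k` and contracted by the
factor `s`. -/
noncomputable def tile {n : ℕ} {V ι : Type*} [AddCommMonoid V] [Fintype ι] (c : ι → Pt n) (s : ℝ)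
    (q : Pt n → V) (x : Pt n) : V :=
  ∑ k, q (s⁻¹ • (x - c k))

/-- The cells `c k + s Q` are pairwise disjoint. -/
def DisjointCells {n : ℕ} {ι : Type*} (Q : Set (Pt n)) (c : ι → Pt n) (s : ℝ) : Prop :=
  ∀ x k l, s⁻¹ • (x - c k) ∈ Q → s⁻¹ • (x - c l) ∈ Q → k = l

section Tile

variable {n : ℕ} {V ι : Type*} [Fintype ι] {c : ι → Pt n} {s : ℝ} {Q : Set (Pt n)}

theorem tile_eq_of_mem [AddCommMonoid V] (hd : DisjointCells Q c s) {q : Pt n → V}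
    (hq : ∀ y ∉ Q, q y = 0) {x : Pt n} {k : ι} (hx : s⁻¹ • (x - c k) ∈ Q) :
    tile c s q x = q (s⁻¹ • (x - c k)) :=
  Finset.sum_eq_single k (fun l _ hl => hq _ fun h => hl (hd x l k h hx)) (by simp)

theorem tile_eq_zero [AddCommMonoid V] {q : Pt n → V} (hq : ∀ y ∉ Q, q y = 0) {x : Pt n}
    (hx : ∀ k, s⁻¹ • (x - c k) ∉ Q) : tile c s q x = 0 :=
  Finset.sum_eq_zero fun k _ => hq _ (hx k)

theorem norm_tile_le [NormedAddCommGroup V] (hd : DisjointCells Q c s) {q : Pt n → V}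
    (hq : ∀ y ∉ Q, q y = 0) {M : ℝ} (hM : ∀ y, ‖q y‖ ≤ M) (x : Pt n) : ‖tile c s q x‖ ≤ M := by
  by_cases h : ∃ k, s⁻¹ • (x - c k) ∈ Q
  · obtain ⟨k, hk⟩ := h
    rw [tile_eq_of_mem hd hq hk]
    exact hM _
  · push Not at h
    rw [tile_eq_zero hq h, norm_zero]
    exact (norm_nonneg _).trans (hM 0)

theorem integral_comp_rescale (q : Pt n → ℝ) (a : Pt n) (hs : 0 ≤ s) :
    ∫ x, q (s⁻¹ • (x - a)) = s ^ n * ∫ x, q x := by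
  rw [integral_sub_right_eq_self (fun x => q (s⁻¹ • x)) a,
    Measure.integral_comp_inv_smul_of_nonneg volume q hs, finrank_euclideanSpace_fin, smul_eq_mul]

theorem integrable_comp_rescale {q : Pt n → ℝ} (hq : Integrable q) (a : Pt n) (hs : 0 < s) :
    Integrable fun x => q (s⁻¹ • (x - a)) :=
  (hq.comp_smul (inv_ne_zero hs.ne')).comp_sub_right a

theorem integrable_tile {q : Pt n → ℝ} (hq : Integrable q) (hs : 0 < s) :
    Integrable (tile c s q) :=
  integrable_finsetSum _ fun k _ => integrable_comp_rescale hq (c k) hs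

theorem integral_tile {q : Pt n → ℝ} (hq : Integrable q) (hs : 0 < s) :
    ∫ x, tile c s q x = Fintype.card ι * s ^ n * ∫ x, q x := by
  simp only [tile]
  rw [integral_finsetSum _ fun k _ => integrable_comp_rescale hq (c k) hs]
  simp [integral_comp_rescale q _ hs.le, mul_assoc]

/-- The conjugates of `φ` living in disjoint cells can be composed to a single element of `G` as
soon as `φ` maps `Q` into itself, so that no conjugate moves a point out of its cell. Nothing
guarantees that `φ` is injective, hence this does not follow from the supports being disjoint. -/
theorem exists_glued {G : Set (Pt n → Pt n)} (hG : IsInnerSemigroup G) [Nonempty ι] (hs : 0 < s)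
    (hd : DisjointCells Q c s) {φ : Pt n → Pt n} (hφ : φ ∈ G) (hQ : MapsTo φ Q Q)
    (hφQ : ∀ y ∉ Q, φ y = y) :
    ∃ Ψ ∈ G, ∀ x, Ψ x = x + s • tile c s (φ - id) x := by
  classical
  set ψ : ι → Pt n → Pt n := fun k => homTrans 0 (c k) s ∘ φ ∘ homTrans (c k) 0 s⁻¹ with hψ
  have hψG : ∀ k, ψ k ∈ G := fun k => hG.conj_mem φ hφ 0 (c k) s hs
  have hψx : ∀ k x, ψ k x = c k + s • φ (s⁻¹ • (x - c k)) := by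
    intro k x
    simp [hψ, homTrans]
  have hψin : ∀ k x, s⁻¹ • (x - c k) ∈ Q → s⁻¹ • (ψ k x - c k) ∈ Q := by
    intro k x hx
    rw [hψx, add_sub_cancel_left, inv_smul_smul₀ hs.ne']
    exact hQ hx
  have hψout : ∀ k x, s⁻¹ • (x - c k) ∉ Q → ψ k x = x := by
    intro k x hx
    rw [hψx, hφQ _ hx, smul_inv_smul₀ hs.ne', add_sub_cancel]
  have key : ∀ S : Finset ι, S.Nonempty → ∃ Ψ ∈ G,
      (∀ k ∈ S, ∀ x, s⁻¹ • (x - c k) ∈ Q → Ψ x = ψ k x) ∧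
      ∀ x, (∀ k ∈ S, s⁻¹ • (x - c k) ∉ Q) → Ψ x = x := by
    intro S hS
    induction hS using Finset.Nonempty.cons_induction with
    | singleton a =>
      refine ⟨ψ a, hψG a, ?_, ?_⟩
      · intro k hk x _
        rw [Finset.mem_singleton.1 hk]
      · intro x hx
        exact hψout a x (hx a (Finset.mem_singleton_self a))
    | cons a S ha hS ih =>
      obtain ⟨Ψ, hΨG, hΨ1, hΨ2⟩ := ih
      refine ⟨Ψ ∘ ψ a, hG.comp_mem _ hΨG _ (hψG a), ?_, ?_⟩
      · intro k hk x hx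
        rcases Finset.mem_cons.1 hk with rfl | hk
        · refine hΨ2 _ fun l hl h => ha ?_
          rwa [hd _ _ _ (hψin k x hx) h]
        · have : ψ a x = x := hψout a x fun h => ha (by rwa [hd _ _ _ h hx])
          rw [Function.comp_apply, this]
          exact hΨ1 k hk x hx
      · intro x hx
        rw [Function.comp_apply, hψout a x (hx a (Finset.mem_cons_self a S))]
        exact hΨ2 x fun k hk => hx k (Finset.mem_cons_of_mem hk)
  obtain ⟨Ψ, hΨG, hΨ1, hΨ2⟩ := key Finset.univ Finset.univ_nonempty
  have hv : ∀ y ∉ Q, (φ - id : Pt n → Pt n) y = 0 := fun y hy => by simp [hφQ y hy]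
  refine ⟨Ψ, hΨG, fun x => ?_⟩
  by_cases h : ∃ k, s⁻¹ • (x - c k) ∈ Q
  · obtain ⟨k, hk⟩ := h
    rw [tile_eq_of_mem hd hv hk, hΨ1 k (Finset.mem_univ k) x hk, hψx, Pi.sub_apply, id,
      smul_sub s (φ _), smul_inv_smul₀ hs.ne']
    abel
  · push Not at h
    rw [tile_eq_zero hv h, smul_zero, add_zero]
    exact hΨ2 x fun k _ => h k

theorem fderiv_glued (hs : 0 < s) {v Ψ : Pt n → Pt n} (hv : ContDiff ℝ 1 v)
    (hΨ : ∀ x, Ψ x = x + s • tile c s v x) (x : Pt n) :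
    fderiv ℝ Ψ x = ContinuousLinearMap.id ℝ (Pt n) + tile c s (fderiv ℝ v) x := by
  have h1 : ∀ k : ι, HasFDerivAt (fun x => v (s⁻¹ • (x - c k)))
      ((fderiv ℝ v (s⁻¹ • (x - c k))).comp (s⁻¹ • ContinuousLinearMap.id ℝ (Pt n))) x := fun k =>
    HasFDerivAt.comp x (hv.differentiable one_ne_zero _).hasFDerivAt
      (((hasFDerivAt_id x).sub_const (c k)).const_smul s⁻¹)
  have h2 := (hasFDerivAt_id x).add ((HasFDerivAt.fun_sum fun k (_ : k ∈ Finset.univ) =>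
    h1 k).const_smul s)
  have h3 : Ψ = id + s • fun x => ∑ k, v (s⁻¹ • (x - c k)) := by
    funext x
    simp [hΨ, tile]
  rw [h3, h2.fderiv]
  simp [tile, Finset.smul_sum, smul_smul, hs.ne']

end Tile

/-! ### The flow of a compactly supported vector field for small times -/

/-- The first order expansion of the flow in time, uniform in space and in `C¹`:
`∇φ_t = 1 + t ∇η + O(t²)` as `t → 0⁺`. It follows by applying the mean value inequality in time to
the differences `φ_t(x) - φ_t(y)`, so that no differentiability of the flow jointly in time and
space is needed. -/
theorem exists_norm_fderiv_flow_sub_le {n : ℕ} {η : Pt n → Pt n} (hη : ContDiff ℝ ∞ η)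
    (hc : HasCompactSupport η) {a b : ℝ} {φ : ℝ → Pt n → Pt n} (ha : a < 0) (hb : 0 < b)
    (h0 : φ 0 = id)
    (hφ : ∀ t ∈ Ioo a b, ∀ x, HasDerivAt (fun s => φ s x) (η (φ t x)) t)
    (hC : ∀ t ∈ Ioo a b, ContDiff ℝ 1 (φ t)) :
    ∃ C τ : ℝ, 0 ≤ C ∧ 0 < τ ∧ τ < b ∧ ∀ t ∈ Icc 0 τ, ∀ x,
      ‖fderiv ℝ (φ t) x - ContinuousLinearMap.id ℝ (Pt n) - t • fderiv ℝ η x‖ ≤ C * t ^ 2 := by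
  obtain ⟨L, hL⟩ := hη.lipschitzWith_of_hasCompactSupport hc (by simp)
  obtain ⟨L2, hL2⟩ := (hη.fderiv_right (m := ∞) (by simp)).lipschitzWith_of_hasCompactSupport
    (hc.fderiv ℝ) (by simp)
  obtain ⟨M, hM⟩ := hc.exists_bound_of_continuous hη.continuous
  have hM0 : 0 ≤ M := (norm_nonneg _).trans (hM 0)
  obtain ⟨τ, hτ0, hτb⟩ := exists_between hb
  have hI : ∀ {t}, t ∈ Icc 0 τ → t ∈ Ioo a b := fun ht =>
    ⟨ha.trans_le ht.1, ht.2.trans_lt hτb⟩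
  have hηd : Differentiable ℝ η := hη.differentiable (by simp)
  set C0 : ℝ := Real.exp (L * τ)
  have hC0 : 0 ≤ C0 := (Real.exp_pos _).le
  -- Lipschitz bound for `φ_t`, by Grönwall.
  have s0 : ∀ t ∈ Icc 0 τ, ∀ x y, ‖φ t x - φ t y‖ ≤ C0 * ‖x - y‖ := by
    intro t ht x y
    have h := dist_le_of_trajectories_ODE (v := fun _ => η) (K := L) (f := fun s => φ s x)
      (g := fun s => φ s y) (a := 0) (b := τ) (δ := ‖x - y‖) (fun _ => hL)
      (fun s hs => (hφ s (hI hs) x).continuousAt.continuousWithinAt)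
      (fun s hs => (hφ s (hI (Ico_subset_Icc_self hs)) x).hasDerivWithinAt)
      (fun s hs => (hφ s (hI hs) y).continuousAt.continuousWithinAt)
      (fun s hs => (hφ s (hI (Ico_subset_Icc_self hs)) y).hasDerivWithinAt)
      (by simp [h0, dist_eq_norm]) t ht
    rw [dist_eq_norm, sub_zero] at h
    refine h.trans ?_
    rw [mul_comm]
    gcongr
    exact Real.exp_le_exp.2 (mul_le_mul_of_nonneg_left ht.2 L.2)
  have sM : ∀ t ∈ Icc 0 τ, ∀ x, ‖φ t x - x‖ ≤ M * t := by
    intro t ht x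
    have h := norm_image_sub_le_of_norm_deriv_le_segment' (f := fun s => φ s x) (a := 0) (b := τ)
      (fun s hs => (hφ s (hI hs) x).hasDerivWithinAt) (fun s _ => hM _) t ht
    simpa [h0] using h
  -- Lipschitz bound for `φ_t - id`.
  have s1 : ∀ t ∈ Icc 0 τ, ∀ x y, ‖(φ t x - x) - (φ t y - y)‖ ≤ L * C0 * t * ‖x - y‖ := by
    intro t ht x y
    have h := norm_image_sub_le_of_norm_deriv_le_segment' (f := fun s => φ s x - φ s y)
      (C := L * (C0 * ‖x - y‖)) (a := 0) (b := τ)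
      (fun s hs => ((hφ s (hI hs) x).sub (hφ s (hI hs) y)).hasDerivWithinAt)
      (fun s hs => (hL.norm_sub_le _ _).trans
        (mul_le_mul_of_nonneg_left (s0 s (Ico_subset_Icc_self hs) x y) L.2)) t ht
    simp only [h0, id, sub_zero] at h
    calc ‖(φ t x - x) - (φ t y - y)‖ = ‖φ t x - φ t y - (x - y)‖ := by congr 1; abel
      _ ≤ _ := h
      _ = _ := by ring
  have hφd : ∀ t ∈ Icc 0 τ, Differentiable ℝ (φ t) := fun t ht =>
    (hC t (hI ht)).differentiable one_ne_zero
  have s0' : ∀ t ∈ Icc 0 τ, ∀ x, ‖fderiv ℝ (φ t) x‖ ≤ C0 := fun t ht x =>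
    norm_fderiv_le_of_lip' ℝ hC0 (Eventually.of_forall fun y => s0 t ht y x)
  have s1' : ∀ t ∈ Icc 0 τ, ∀ x,
      ‖fderiv ℝ (φ t) x - ContinuousLinearMap.id ℝ (Pt n)‖ ≤ L * C0 * t := by
    intro t ht x
    have h := norm_fderiv_le_of_lip' ℝ (f := fun y => φ t y - y) (x₀ := x)
      (C := L * C0 * t) (mul_nonneg (mul_nonneg L.2 hC0) ht.1)
      (Eventually.of_forall fun y => s1 t ht y x)
    rwa [fderiv_fun_sub (hφd t ht x) differentiableAt_fun_id, fderiv_fun_id] at h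
  -- Lipschitz bound for `η ∘ φ_t - η`, the time derivative of `φ_t - id - t η`.
  set C1 : ℝ := L2 * M * C0 + L * (L * C0) with hC1
  have hC10 : 0 ≤ C1 := by positivity
  have s2 : ∀ t ∈ Icc 0 τ, ∀ x y,
      ‖(η (φ t x) - η x) - (η (φ t y) - η y)‖ ≤ C1 * t * ‖x - y‖ := by
    intro t ht x y
    refine Convex.norm_image_sub_le_of_norm_hasFDerivWithin_le (s := univ)
      (f := fun x => η (φ t x) - η x)
      (f' := fun x => (fderiv ℝ η (φ t x)).comp (fderiv ℝ (φ t) x) - fderiv ℝ η x)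
      (fun z _ => ?_) (fun z _ => ?_) convex_univ (mem_univ y) (mem_univ x)
    · exact (((hηd _).hasFDerivAt.comp z (hφd t ht z).hasFDerivAt).sub
        (hηd z).hasFDerivAt).hasFDerivWithinAt
    · have e1 : (fderiv ℝ η (φ t z)).comp (fderiv ℝ (φ t) z) - fderiv ℝ η z
          = (fderiv ℝ η (φ t z) - fderiv ℝ η z).comp (fderiv ℝ (φ t) z)
            + (fderiv ℝ η z).comp (fderiv ℝ (φ t) z - ContinuousLinearMap.id ℝ (Pt n)) := by
        ext1 w
        simp
      rw [e1]
      calc _ ≤ ‖fderiv ℝ η (φ t z) - fderiv ℝ η z‖ * ‖fderiv ℝ (φ t) z‖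
            + ‖fderiv ℝ η z‖ * ‖fderiv ℝ (φ t) z - ContinuousLinearMap.id ℝ (Pt n)‖ :=
          (norm_add_le _ _).trans (add_le_add (ContinuousLinearMap.opNorm_comp_le _ _)
            (ContinuousLinearMap.opNorm_comp_le _ _))
        _ ≤ (L2 * (M * t)) * C0 + L * (L * C0 * t) := by
          have i1 : ‖fderiv ℝ η (φ t z) - fderiv ℝ η z‖ ≤ L2 * (M * t) :=
            (hL2.norm_sub_le _ _).trans (mul_le_mul_of_nonneg_left (sM t ht z) L2.2)
          have i2 := s0' t ht z
          have i3 : ‖fderiv ℝ η z‖ ≤ L := norm_fderiv_le_of_lipschitz ℝ hL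
          have i4 := s1' t ht z
          have ht0 := ht.1
          gcongr
        _ = C1 * t := by rw [hC1]; ring
  have s3 : ∀ t ∈ Icc 0 τ, ∀ x y,
      ‖(φ t x - x - t • η x) - (φ t y - y - t • η y)‖ ≤ C1 * t ^ 2 * ‖x - y‖ := by
    intro t ht x y
    have hsub : ∀ {s}, s ∈ Icc 0 t → s ∈ Icc 0 τ := fun hs => ⟨hs.1, hs.2.trans ht.2⟩
    have h := norm_image_sub_le_of_norm_deriv_le_segment'
      (f := fun s => (φ s x - s • η x) - (φ s y - s • η y))
      (f' := fun s => (η (φ s x) - η x) - (η (φ s y) - η y))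
      (C := C1 * t * ‖x - y‖) (a := 0) (b := t)
      (fun s hs => by
        have d : ∀ z, HasDerivAt (fun s => φ s z - s • η z) (η (φ s z) - η z) s := fun z => by
          simpa using (hφ s (hI (hsub hs)) z).fun_sub ((hasDerivAt_id s).smul_const (η z))
        exact ((d x).sub (d y)).hasDerivWithinAt)
      (fun s hs => (s2 s (hsub (Ico_subset_Icc_self hs)) x y).trans (by
        gcongr
        exact hs.2.le)) t (right_mem_Icc.2 ht.1)
    simp only [h0, id, sub_zero, zero_smul] at h
    calc _ = ‖φ t x - t • η x - (φ t y - t • η y) - (x - y)‖ := by congr 1; abel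
      _ ≤ _ := h
      _ = _ := by ring
  refine ⟨C1, τ, hC10, hτ0, hτb, fun t ht x => ?_⟩
  have h := norm_fderiv_le_of_lip' ℝ (f := fun y => φ t y - y - t • η y) (x₀ := x)
    (C := C1 * t ^ 2) (by positivity) (Eventually.of_forall fun y => s3 t ht y x)
  have hd := ((hφd t ht x).hasFDerivAt.fun_sub (hasFDerivAt_id x)).fun_sub
    ((hηd x).hasFDerivAt.fun_const_smul t)
  rwa [show fderiv ℝ (fun y => φ t y - y - t • η y) x = _ from hd.fderiv] at h

/-- Outside the support of the field the flow is stationary. -/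
theorem support_flow_sub_id_subset {n : ℕ} {η : Pt n → Pt n} {L : NNReal}
    (hL : LipschitzWith L η) {a b : ℝ} {φ : ℝ → Pt n → Pt n} (ha : a < 0) (hb : 0 < b)
    (h0 : φ 0 = id)
    (hφ : ∀ t ∈ Ioo a b, ∀ x, HasDerivAt (fun s => φ s x) (η (φ t x)) t)
    {t : ℝ} (ht : t ∈ Ioo a b) : Function.support (φ t - id) ⊆ tsupport η := by
  intro x hx
  by_contra hxη
  have hηx : η x = 0 := image_eq_zero_of_notMem_tsupport hxη
  refine hx ?_
  have h := ODE_solution_unique_of_mem_Ioo (v := fun _ => η) (K := L) (s := fun _ => univ)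
    (f := fun s => φ s x) (g := fun _ => x) (t₀ := 0) (fun _ _ => hL.lipschitzOnWith)
    ⟨ha, hb⟩ (fun s hs => ⟨hφ s hs x, mem_univ _⟩)
    (fun s _ => ⟨by simpa [hηx] using hasDerivAt_const s x, mem_univ _⟩) (by simp [h0]) ht
  simpa [sub_eq_zero] using h

theorem suppIn_flow_sub_id {n : ℕ} {η : Pt n → Pt n} {Ω : Set (Pt n)} {L : NNReal}
    (hL : LipschitzWith L η) (hη : SuppIn η Ω) {a b : ℝ} {φ : ℝ → Pt n → Pt n} (ha : a < 0)
    (hb : 0 < b) (h0 : φ 0 = id)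
    (hφ : ∀ t ∈ Ioo a b, ∀ x, HasDerivAt (fun s => φ s x) (η (φ t x)) t)
    {t : ℝ} (ht : t ∈ Ioo a b) : SuppIn (φ t - id) Ω := by
  have h := support_flow_sub_id_subset hL ha hb h0 hφ ht
  exact ⟨hη.1.mono' h, (closure_minimal h (isClosed_tsupport η)).trans hη.2⟩

/-! ### Second order expansion of the integrand -/

/-- Taylor's formula of order two with Peano remainder. Along a segment the remainder is a function
of one variable, so the symmetry of the second derivative is not needed. -/
theorem exists_taylor_two {E : Type*} [NormedAddCommGroup E] [NormedSpace ℝ E] {W : E → ℝ} {F : E}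
    (hW : ContDiffAt ℝ 2 W F) {ε : ℝ} (hε : 0 < ε) :
    ∃ δ > 0, ∀ H : E, ‖H‖ < δ →
      |W (F + H) - W F - fderiv ℝ W F H - fderiv ℝ (fderiv ℝ W) F H H / 2| ≤ ε * ‖H‖ ^ 2 := by
  have hd : ∀ᶠ A in 𝓝 F, DifferentiableAt ℝ W A := by
    filter_upwards [hW.eventually (by simp)] with A hA
    exact hA.differentiableAt (by simp)
  have hd2 : HasFDerivAt (fderiv ℝ W) (fderiv ℝ (fderiv ℝ W) F) F :=
    ((hW.fderiv_right (m := 1) (by norm_num)).differentiableAt (by simp)).hasFDerivAt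
  have hlo := (hasFDerivAt_iff_isLittleO_nhds_zero.1 hd2).def hε
  have hd' : ∀ᶠ H in 𝓝 (0 : E), DifferentiableAt ℝ W (F + H) := by
    have : Tendsto (fun H : E => F + H) (𝓝 0) (𝓝 F) := by
      simpa using (continuous_const_add F).tendsto (0 : E)
    exact this.eventually hd
  obtain ⟨δ, hδ, h⟩ := Metric.eventually_nhds_iff_ball.1 (hlo.and hd')
  refine ⟨δ, hδ, fun H hH => ?_⟩
  set D := fderiv ℝ W F
  set B := fderiv ℝ (fderiv ℝ W) F
  have hin : ∀ r ∈ Icc (0 : ℝ) 1, r • H ∈ Metric.ball (0 : E) δ := by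
    intro r hr
    rw [mem_ball_zero_iff, norm_smul, Real.norm_of_nonneg hr.1]
    exact (mul_le_of_le_one_left (norm_nonneg _) hr.2).trans_lt hH
  have key := norm_image_sub_le_of_norm_deriv_le_segment_01'
    (f := fun r : ℝ => W (F + r • H) - r * D H - r ^ 2 / 2 * B H H)
    (f' := fun r => (fderiv ℝ W (F + r • H) - D - B (r • H)) H) (C := ε * ‖H‖ ^ 2)
    (fun r hr => ?_) (fun r hr => ?_)
  · simpa [Real.norm_eq_abs, sub_right_comm _ _ (W F), div_eq_inv_mul] using key
  · have d1 : HasDerivAt (fun r : ℝ => F + r • H) H r := by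
      simpa using ((hasDerivAt_id r).smul_const H).const_add F
    have d2 := (h _ (hin r hr)).2.hasFDerivAt.comp_hasDerivAt r d1
    have d3 := (d2.sub ((hasDerivAt_id r).mul_const (D H))).sub
      ((((hasDerivAt_id r).pow 2).div_const 2).mul_const (B H H))
    refine (d3.congr_deriv ?_).hasDerivWithinAt
    simp
  · have hr' := Ico_subset_Icc_self hr
    have h1 := (h _ (hin r hr')).1
    calc _ ≤ ‖fderiv ℝ W (F + r • H) - D - B (r • H)‖ * ‖H‖ := ContinuousLinearMap.le_opNorm _ _
      _ ≤ (ε * ‖r • H‖) * ‖H‖ := by gcongr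
      _ ≤ (ε * ‖H‖) * ‖H‖ := by
        gcongr
        rw [norm_smul, Real.norm_of_nonneg hr.1]
        exact mul_le_of_le_one_left (norm_nonneg _) hr.2.le
      _ = _ := by ring

/-! ### The Legendre–Hadamard equality -/

theorem eq_zero_of_forall_abs_le_mul {a C : ℝ} (h : ∀ ε > 0, |a| ≤ C * ε) : a = 0 := by
  have h1 : Tendsto (fun ε : ℝ => C * ε) (𝓝[>] 0) (𝓝 0) := by
    have : Tendsto (fun ε : ℝ => C * ε) (𝓝 0) (𝓝 (C * 0)) := tendsto_id.const_mul C
    rw [mul_zero] at this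
    exact this.mono_left nhdsWithin_le_nhds
  exact abs_nonpos_iff.1 (ge_of_tendsto h1 (eventually_mem_nhdsWithin.mono h))

theorem integrableOn_of_continuous {n : ℕ} {Ω : Set (Pt n)} (hΩb : Bornology.IsBounded Ω)
    {f : Pt n → ℝ} (hf : Continuous f) : IntegrableOn f Ω :=
  (hf.continuousOn.integrableOn_compact hΩb.isCompact_closure).mono_set subset_closure

theorem setIntegral_fderiv_eq_zero {n : ℕ} {Ω : Set (Pt n)} {v : Pt n → Pt n}
    (hv : ContDiff ℝ 1 v) (hs : SuppIn v Ω) : ∫ x in Ω, fderiv ℝ v x = 0 := by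
  rw [setIntegral_eq_integral_of_forall_compl_eq_zero, integral_fderiv_eq_zero hv hs.1]
  exact fun x hx => fderiv_of_notMem_tsupport (𝕜 := ℝ) fun h => hx (hs.2 h)

theorem energy_homogeneous_comp {n : ℕ} {Ω : Set (Pt n)} (W : Mat n → ℝ) (F : Mat n)
    {φ : Pt n → Pt n} (hφ : ContDiff ℝ 1 φ) :
    energy (homogeneous W) Ω (F ∘ φ) = ∫ x in Ω, W (F.comp (fderiv ℝ φ x)) := by
  have h : ∀ x, fderiv ℝ (F ∘ φ) x = F.comp (fderiv ℝ φ x) := fun x =>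
    (F.hasFDerivAt.comp x (hφ.differentiable one_ne_zero x).hasFDerivAt).fderiv
  simp only [energy, homogeneous, h]

theorem energy_homogeneous_linear {n : ℕ} {Ω : Set (Pt n)} (W : Mat n → ℝ) (F : Mat n) :
    energy (homogeneous W) Ω F = ∫ _x in Ω, W F := by
  simp only [energy, homogeneous, ContinuousLinearMap.fderiv]

theorem exists_abs_bilinear_le {E : Type*} [NormedAddCommGroup E] [NormedSpace ℝ E]
    (B : E →L[ℝ] E →L[ℝ] ℝ) : ∃ β, 0 ≤ β ∧ ∀ X Y, |B X Y| ≤ β * ‖X‖ * ‖Y‖ :=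
  ⟨‖B‖, norm_nonneg B, B.le_opNorm₂⟩

/-- The coordinate free form of the Legendre–Hadamard equality. Since `∫ (∇φ_t - 1) = 0`,
subtracting the linear part of `W` at `F` from the identity `∫ W(F ∇φ_t) = ∫ W(F)` costs nothing;
what remains is `t² / 2` times the integral below up to `o(t²)`. -/
theorem integral_second_fderiv_eq_zero {n : ℕ} {G : Set (Pt n → Pt n)} (hG : IsInnerSemigroup G)
    {Ω : Set (Pt n)} (hΩb : Bornology.IsBounded Ω) {U : Set (Mat n)} {W : Mat n → ℝ}
    (hU : IsOpen U) (hGU : jet G ⊆ U) (hW : ContDiffOn ℝ 2 W U)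
    (hnull : IsLeftNullLagrangian G Ω W) {F : Mat n} (hF : F ∈ jet G) {η : Pt n → Pt n}
    (hη : η ∈ tangent G Ω) :
    ∫ x in Ω, fderiv ℝ (fderiv ℝ W) F (F.comp (fderiv ℝ η x)) (F.comp (fderiv ℝ η x)) = 0 := by
  obtain ⟨hηC, hηs, a, b, φ, ha, hb, h0, hφ, hφG⟩ := hη
  have hφC : ∀ t ∈ Ioo a b, ContDiff ℝ 1 (φ t) := fun t ht => hG.contDiff _ (hφG t ht)
  obtain ⟨C, τ, hC, hτ, hτb, hexp⟩ :=
    exists_norm_fderiv_flow_sub_le hηC hηs.1 ha hb h0 hφ hφC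
  obtain ⟨L, hL⟩ := hηC.lipschitzWith_of_hasCompactSupport hηs.1 (by simp)
  set D := fderiv ℝ W F
  set B := fderiv ℝ (fderiv ℝ W) F
  set P : Pt n → Mat n := fun x => F.comp (fderiv ℝ η x) with hP
  set p : ℝ := ‖F‖ * L
  set q : ℝ := ‖F‖ * C
  have hp0 : 0 ≤ p := by positivity
  have hq0 : 0 ≤ q := by positivity
  have hPp : ∀ x, ‖P x‖ ≤ p := fun x => (ContinuousLinearMap.opNorm_comp_le _ _).trans
    (mul_le_mul_of_nonneg_left (norm_fderiv_le_of_lipschitz ℝ hL) (norm_nonneg _))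
  have hPc : Continuous P :=
    continuous_const.clm_comp (hηC.continuous_fderiv (by simp))
  have hBc : Continuous fun x => B (P x) (P x) := (B.continuous.comp hPc).clm_apply hPc
  obtain ⟨β, hβ, hB⟩ := exists_abs_bilinear_le B
  set κ : ℝ := β * (2 * p * q + q ^ 2) / 2 with hκ
  have hκ0 : 0 ≤ κ := by positivity
  refine eq_zero_of_forall_abs_le_mul (C := 2 * (((p + q) ^ 2 + 1) * volume.real Ω))
    fun ε hε => ?_
  obtain ⟨δ, hδ, htay⟩ := exists_taylor_two (hW.contDiffAt (hU.mem_nhds (hGU hF))) hε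
  -- A time at which all the error terms are small.
  obtain ⟨t, ht0, ht⟩ : ∃ t : ℝ, 0 < t ∧ t ≤ τ ∧ t ≤ 1 ∧ (p + q) * t < δ ∧ κ * t < ε := by
    have e1 : ∀ r s : ℝ, 0 < s → ∀ᶠ t : ℝ in 𝓝[>] 0, r * t < s := by
      intro r s hs
      have : Tendsto (fun t : ℝ => r * t) (𝓝 0) (𝓝 (r * 0)) := tendsto_id.const_mul r
      rw [mul_zero] at this
      exact (this.mono_left nhdsWithin_le_nhds).eventually (gt_mem_nhds hs)
    obtain ⟨t, h⟩ := (eventually_mem_nhdsWithin.and ((e1 1 τ hτ).and ((e1 1 1 one_pos).and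
      ((e1 (p + q) δ hδ).and (e1 κ ε hε))))).exists
    exact ⟨t, h.1, by linarith [h.2.1], by linarith [h.2.2.1], h.2.2.2.1, h.2.2.2.2⟩
  obtain ⟨htτ, ht1, htδ, htε⟩ := ht
  have htI : t ∈ Ioo a b := ⟨ha.trans ht0, htτ.trans_lt hτb⟩
  have hφtC := hφC t htI
  have hsupp : SuppIn (φ t - id) Ω := suppIn_flow_sub_id hL hηs ha hb h0 hφ htI
  set H : Pt n → Mat n := fun x => F.comp (fderiv ℝ (φ t - id) x) with hH
  have hFH : ∀ x, F + H x = F.comp (fderiv ℝ (φ t) x) := by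
    intro x
    simp only [hH, fderiv_sub_id hφtC]
    ext1 y
    simp
  have hHc : Continuous H :=
    continuous_const.clm_comp ((contDiff_sub_id hφtC).continuous_fderiv one_ne_zero)
  have hHP : ∀ x, ‖H x - t • P x‖ ≤ q * t ^ 2 := by
    intro x
    have : H x - t • P x = F.comp
        (fderiv ℝ (φ t) x - ContinuousLinearMap.id ℝ (Pt n) - t • fderiv ℝ η x) := by
      simp only [hH, hP, fderiv_sub_id hφtC]
      ext1 y
      simp
    rw [this, mul_assoc]
    exact (ContinuousLinearMap.opNorm_comp_le _ _).trans
      (mul_le_mul_of_nonneg_left (hexp t ⟨ht0.le, htτ⟩ x) (norm_nonneg _))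
  have htt : t ^ 2 ≤ t := by nlinarith
  have hHn : ∀ x, ‖H x‖ ≤ (p + q) * t := by
    intro x
    calc ‖H x‖ = ‖(H x - t • P x) + t • P x‖ := by rw [sub_add_cancel]
      _ ≤ ‖H x - t • P x‖ + ‖t • P x‖ := norm_add_le _ _
      _ ≤ q * t ^ 2 + t * p := by
        rw [norm_smul, Real.norm_of_nonneg ht0.le]
        exact add_le_add (hHP x) (mul_le_mul_of_nonneg_left (hPp x) ht0.le)
      _ ≤ (p + q) * t := by nlinarith
  have hpt : ∀ x, ‖W (F + H x) - W F - D (H x) - t ^ 2 / 2 * B (P x) (P x)‖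
      ≤ ((p + q) ^ 2 + 1) * ε * t ^ 2 := by
    intro x
    have i1 := htay (H x) ((hHn x).trans_lt htδ)
    have i2 : |B (H x) (H x) / 2 - t ^ 2 / 2 * B (P x) (P x)| ≤ κ * t * t ^ 2 := by
      set S := H x - t • P x with hS
      have hHS : H x = t • P x + S := by rw [hS]; abel
      have e2 : B (H x) (H x) / 2 - t ^ 2 / 2 * B (P x) (P x)
          = (t * B (P x) S + t * B S (P x) + B S S) / 2 := by
        rw [hHS]
        simp only [map_add, map_smul, add_apply, smul_apply,
          smul_eq_mul]
        ring
      have hSn : ‖S‖ ≤ q * t ^ 2 := hHP x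
      have j : ∀ X Y : Mat n, ∀ α γ : ℝ, ‖X‖ ≤ α → ‖Y‖ ≤ γ → 0 ≤ α →
          |B X Y| ≤ β * α * γ := fun X Y α γ hX hY hα =>
        (hB X Y).trans (by gcongr)
      have j1 := j _ _ _ _ (hPp x) hSn hp0
      have j2 := j _ _ _ _ hSn (hPp x) (by positivity)
      have j3 := j _ _ _ _ hSn hSn (by positivity)
      rw [e2, abs_div, abs_two]
      calc _ ≤ (t * (β * p * (q * t ^ 2)) + t * (β * (q * t ^ 2) * p)
            + β * (q * t ^ 2) * (q * t ^ 2)) / 2 := by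
            refine div_le_div_of_nonneg_right ?_ two_pos.le
            refine (abs_add_le _ _).trans (add_le_add ((abs_add_le _ _).trans ?_) j3)
            rw [abs_mul, abs_mul, abs_of_pos ht0]
            gcongr
        _ = β * (2 * p * q + q ^ 2 * t) / 2 * t * t ^ 2 := by ring
        _ ≤ _ := by
            rw [hκ]
            gcongr
            exact mul_le_of_le_one_right (by positivity) ht1
    have i3 : ε * ‖H x‖ ^ 2 ≤ ε * ((p + q) * t) ^ 2 := by
      gcongr
      exact hHn x
    have i4 : κ * t * t ^ 2 ≤ ε * t ^ 2 := by gcongr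
    calc _ = |(W (F + H x) - W F - D (H x) - B (H x) (H x) / 2)
          + (B (H x) (H x) / 2 - t ^ 2 / 2 * B (P x) (P x))| := by
            rw [Real.norm_eq_abs]; congr 1; ring
      _ ≤ ε * ((p + q) * t) ^ 2 + ε * t ^ 2 :=
        (abs_add_le _ _).trans (add_le_add (i1.trans i3) (i2.trans i4))
      _ = _ := by ring
  have c1 : Continuous fun x => W (F + H x) :=
    hW.continuousOn.comp_continuous (continuous_const.add hHc) fun x => by
      rw [hFH]
      exact hGU (jet_comp_mem hG hF (fderiv_mem_jet hG (hφG t htI) x))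
  have c2 : Continuous fun x => D (H x) := D.continuous.comp hHc
  have n1 : ∫ x in Ω, W (F + H x) = ∫ _x in Ω, W F := by
    have := hnull F hF (φ t) ⟨hφG t htI, hsupp⟩
    rw [energy_homogeneous_comp W F hφtC, energy_homogeneous_linear] at this
    simpa only [hFH] using this
  have n2 : ∫ x in Ω, D (H x) = 0 := by
    have hi : Integrable (fderiv ℝ (φ t - id)) (volume.restrict Ω) :=
      (integrable_fderiv_of_hasCompactSupport (contDiff_sub_id hφtC) hsupp.1).restrict
    have := (D.comp (ContinuousLinearMap.compL ℝ (Pt n) (Pt n) (Pt n) F)).integral_comp_comm hi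
    rw [setIntegral_fderiv_eq_zero (contDiff_sub_id hφtC) hsupp, map_zero] at this
    exact this
  have hfin : volume Ω < ⊤ := hΩb.measure_lt_top
  have hint := norm_setIntegral_le_of_norm_le_const (μ := volume) hfin (fun x _ => hpt x)
  have k1 := integrableOn_of_continuous hΩb c1
  have k0 := integrableOn_of_continuous hΩb (continuous_const (y := W F))
  have k2 := integrableOn_of_continuous hΩb c2
  have k3 := integrableOn_of_continuous hΩb (hBc.const_mul (t ^ 2 / 2))
  have k10 : IntegrableOn (fun x => W (F + H x) - W F) Ω := k1.sub k0
  have k102 : IntegrableOn (fun x => W (F + H x) - W F - D (H x)) Ω := k10.sub k2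
  rw [integral_sub k102 k3, integral_sub k10 k2, integral_sub k1 k0, n1, n2,
    integral_const_mul, sub_self, sub_zero, zero_sub, norm_neg, norm_mul, Real.norm_eq_abs,
    Real.norm_eq_abs, abs_of_pos (by positivity)] at hint
  have ht2 : 0 < t ^ 2 := by positivity
  refine le_of_mul_le_mul_left ?_ ht2
  linarith

theorem eq_sum_entry_smul_elem {n : ℕ} (P : Mat n) :
    P = ∑ i, ∑ j, entry P i j • (elem i j : Mat n) := by
  ext1 x
  have hx : x = ∑ j, x j • (e j : Pt n) := by
    ext l
    simp [e, Finset.sum_apply, Pi.single_apply]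
  ext l
  conv_lhs => rw [hx]
  simp [elem, entry, e, Finset.sum_apply, Pi.single_apply, mul_comm]

theorem entry_comp {n : ℕ} (F N : Mat n) (i j : Fin n) :
    entry (F.comp N) i j = ∑ k, entry F i k * entry N k j := by
  have hx : N (e j) = ∑ k, (N (e j)) k • (e k : Pt n) := by
    ext l
    simp [e, Finset.sum_apply, Pi.single_apply]
  simp only [entry, ContinuousLinearMap.comp_apply]
  conv_lhs => rw [hx]
  simp [mul_comm]

theorem linear_eq_sum {n : ℕ} (l : Mat n →L[ℝ] ℝ) (P : Mat n) :
    l P = ∑ i, ∑ j, entry P i j * l (elem i j) := by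
  conv_lhs => rw [eq_sum_entry_smul_elem P]
  simp only [map_sum, map_smul, smul_eq_mul]

theorem bilinear_eq_sum {n : ℕ} (B : Mat n →L[ℝ] Mat n →L[ℝ] ℝ) (F N : Mat n) :
    B (F.comp N) (F.comp N) = ∑ i, ∑ j, ∑ m, ∑ r, ∑ k, ∑ p,
      B (elem i j) (elem m r) * entry F i k * entry F m p * (entry N k j * entry N p r) := by
  have h := linear_eq_sum (B.flip (F.comp N)) (F.comp N)
  simp only [ContinuousLinearMap.flip_apply] at h
  rw [h]
  refine Finset.sum_congr rfl fun i _ => Finset.sum_congr rfl fun j _ => ?_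
  rw [linear_eq_sum (B (elem i j)), Finset.mul_sum]
  refine Finset.sum_congr rfl fun m _ => ?_
  rw [Finset.mul_sum]
  refine Finset.sum_congr rfl fun r _ => ?_
  rw [entry_comp, entry_comp, ← mul_assoc, Finset.sum_mul_sum, Finset.sum_mul]
  refine Finset.sum_congr rfl fun k _ => ?_
  rw [Finset.sum_mul]
  refine Finset.sum_congr rfl fun p _ => ?_
  ring

theorem continuous_entry {n : ℕ} (i j : Fin n) : Continuous fun F : Mat n => entry F i j := by
  unfold entry
  fun_prop

theorem legendre_hadamard {n : ℕ} {G : Set (Pt n → Pt n)} (hG : IsInnerSemigroup G)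
    {Ω : Set (Pt n)} (hΩb : Bornology.IsBounded Ω) {U : Set (Mat n)} {W : Mat n → ℝ}
    (hU : IsOpen U) (hGU : jet G ⊆ U) (hW : ContDiffOn ℝ 2 W U)
    (hnull : IsLeftNullLagrangian G Ω W) {F : Mat n} (hF : F ∈ jet G) {η : Pt n → Pt n}
    (hη : η ∈ tangent G Ω) :
    ∑ i, ∑ j, ∑ m, ∑ r, ∑ k, ∑ p,
      secondPartial W F i j m r * entry F i k * entry F m p *
        ∫ x in Ω, entry (fderiv ℝ η x) k j * entry (fderiv ℝ η x) p r = 0 := by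
  have hd : DifferentiableAt ℝ (fderiv ℝ W) F :=
    ((hW.contDiffAt (hU.mem_nhds (hGU hF))).fderiv_right (m := 1) (by norm_num)).differentiableAt
      (by simp)
  have hsp : ∀ i j m r, secondPartial W F i j m r
      = fderiv ℝ (fderiv ℝ W) F (elem i j) (elem m r) := by
    intro i j m r
    rw [secondPartial, (hd.hasFDerivAt.clm_apply (hasFDerivAt_const (elem m r) F)).fderiv]
    simp
  have hc := hη.1.continuous_fderiv (by simp)
  have hi : ∀ k j p r, IntegrableOn
      (fun x => entry (fderiv ℝ η x) k j * entry (fderiv ℝ η x) p r) Ω := fun k j p r =>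
    integrableOn_of_continuous hΩb
      (((continuous_entry k j).comp hc).mul ((continuous_entry p r).comp hc))
  rw [← integral_second_fderiv_eq_zero hG hΩb hU hGU hW hnull hF hη]
  simp only [bilinear_eq_sum, hsp, ← integral_const_mul]
  symm
  have hI : ∀ i j m r k p, Integrable (fun x => fderiv ℝ (fderiv ℝ W) F (elem i j) (elem m r) *
      entry F i k * entry F m p * (entry (fderiv ℝ η x) k j * entry (fderiv ℝ η x) p r))
      (volume.restrict Ω) := fun i j m r k p => (hi k j p r).const_mul _
  iterate 5
    rw [integral_finsetSum _ fun _ _ => by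
      repeat (first | exact hI _ _ _ _ _ _ | refine integrable_finsetSum _ fun _ _ => ?_)]
    refine Finset.sum_congr rfl fun _ _ => ?_
  rw [integral_finsetSum _ fun _ _ => hI _ _ _ _ _ _]

/-! ### Subdivision of a cube -/

/-- The open cube of half-side `R` centred at the origin. -/
def cube (n : ℕ) (R : ℝ) : Set (Pt n) := {y | ∀ i, |y i| < R}

/-- The centres of the `N ^ n` congruent cubes of half-side `ρ / N` into which the cube of centre
`x₀` and half-side `ρ` is divided. -/
noncomputable def gridCenter {n : ℕ} (x₀ : Pt n) (ρ : ℝ) (N : ℕ) (k : Fin n → Fin N) : Pt n :=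
  x₀ + WithLp.toLp 2 fun i => -ρ + (2 * (k i : ℝ) + 1) * (ρ / N)

/-- The factor contracting a cube of half-side `R` to one of half-side `ρ / N`. -/
noncomputable def gridScale (ρ R : ℝ) (N : ℕ) : ℝ := ρ / N / R

section Grid

variable {n : ℕ} {x₀ : Pt n} {ρ R : ℝ} {N : ℕ}

theorem norm_le_of_forall_abs_le {y : Pt n} (h : ∀ i, |y i| ≤ R) : ‖y‖ ≤ n * R := by
  have hy : y = ∑ j, y j • (e j : Pt n) := by
    ext l
    simp [e, Finset.sum_apply, Pi.single_apply]
  rw [hy]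
  refine (norm_sum_le _ _).trans ((Finset.sum_le_card_nsmul _ _ R fun i _ => ?_).trans (by simp))
  simpa [norm_smul, e] using h i

theorem exists_subset_cube {S : Set (Pt n)} (hS : Bornology.IsBounded S) :
    ∃ R > 0, S ⊆ cube n R := by
  obtain ⟨r, hr0, hr⟩ := hS.subset_ball_lt 0 0
  refine ⟨r, hr0, fun y hy i => ?_⟩
  have h1 : ‖y i‖ ≤ ‖y‖ := PiLp.norm_apply_le y i
  exact h1.trans_lt (by simpa using hr hy)

theorem gridScale_pos (hρ : 0 < ρ) (hR : 0 < R) (hN : 0 < N) : 0 < gridScale ρ R N := by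
  unfold gridScale
  positivity

theorem card_mul_gridScale_pow (hN : 0 < N) :
    (Fintype.card (Fin n → Fin N) : ℝ) * gridScale ρ R N ^ n = (ρ / R) ^ n := by
  have hN' : (N : ℝ) ≠ 0 := by positivity
  rw [Fintype.card_fun, Fintype.card_fin, Fintype.card_fin, Nat.cast_pow, ← mul_pow]
  congr 1
  unfold gridScale
  field_simp

theorem tendsto_gridScale : Tendsto (fun h : ℕ => gridScale ρ R (h + 1)) atTop (𝓝 0) := by
  have h := ((tendsto_const_div_atTop_nhds_zero_nat ρ).comp (tendsto_add_atTop_nat 1)).div_const R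
  rw [zero_div] at h
  exact h

theorem abs_sub_gridCenter_lt (hρ : 0 < ρ) (hR : 0 < R) (hN : 0 < N) {x : Pt n}
    {k : Fin n → Fin N} (hx : (gridScale ρ R N)⁻¹ • (x - gridCenter x₀ ρ N k) ∈ cube n R)
    (i : Fin n) : |x i - x₀ i - (-ρ + (2 * (k i : ℝ) + 1) * (ρ / N))| < ρ / N := by
  have hs := gridScale_pos hρ hR hN
  have h := hx i
  have h1 : ((gridScale ρ R N)⁻¹ • (x - gridCenter x₀ ρ N k)) i
      = (gridScale ρ R N)⁻¹ * (x i - x₀ i - (-ρ + (2 * (k i : ℝ) + 1) * (ρ / N))) := by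
    simp [gridCenter, sub_sub]
  rw [h1, abs_mul, abs_of_pos (inv_pos.2 hs), inv_mul_lt_iff₀ hs] at h
  have h2 : gridScale ρ R N * R = ρ / N := by
    unfold gridScale
    field_simp
  rwa [h2] at h

theorem disjointCells_grid (hρ : 0 < ρ) (hR : 0 < R) (hN : 0 < N) :
    DisjointCells (cube n R) (gridCenter x₀ ρ N) (gridScale ρ R N) := by
  intro x k l hk hl
  funext i
  have h1 := abs_lt.1 (abs_sub_gridCenter_lt hρ hR hN hk i)
  have h2 := abs_lt.1 (abs_sub_gridCenter_lt hρ hR hN hl i)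
  have hd : 0 < ρ / N := by positivity
  have a1 : (k i : ℝ) < l i + 1 := by
    refine lt_of_mul_lt_mul_right (a := ρ / N) ?_ hd.le
    linarith
  have a2 : (l i : ℝ) < k i + 1 := by
    refine lt_of_mul_lt_mul_right (a := ρ / N) ?_ hd.le
    linarith
  have b1 : (k i : ℕ) < l i + 1 := by exact_mod_cast a1
  have b2 : (l i : ℕ) < k i + 1 := by exact_mod_cast a2
  exact Fin.ext (by omega)

theorem norm_sub_le_of_mem_cell (hρ : 0 < ρ) (hR : 0 < R) (hN : 0 < N) {x : Pt n}
    {k : Fin n → Fin N} (hx : (gridScale ρ R N)⁻¹ • (x - gridCenter x₀ ρ N k) ∈ cube n R) :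
    ‖x - x₀‖ ≤ n * ρ := by
  refine norm_le_of_forall_abs_le fun i => ?_
  have h1 := abs_lt.1 (abs_sub_gridCenter_lt hρ hR hN hx i)
  have hd : 0 < ρ / N := by positivity
  have hN' : (N : ℝ) ≠ 0 := by positivity
  have h2 : (N : ℝ) * (ρ / N) = ρ := by field_simp
  have h3 : ((k i : ℝ) + 1) * (ρ / N) ≤ N * (ρ / N) := by
    refine mul_le_mul_of_nonneg_right ?_ hd.le
    exact_mod_cast (k i).2
  have h4 : 0 ≤ (k i : ℝ) * (ρ / N) := by positivity
  rw [PiLp.sub_apply, abs_le]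
  constructor <;> linarith

theorem norm_sub_gridCenter_le (hρ : 0 < ρ) (hR : 0 < R) (hN : 0 < N) {x : Pt n}
    {k : Fin n → Fin N} (hx : (gridScale ρ R N)⁻¹ • (x - gridCenter x₀ ρ N k) ∈ cube n R) :
    ‖x - gridCenter x₀ ρ N k‖ ≤ gridScale ρ R N * (n * R) := by
  have hs := gridScale_pos hρ hR hN
  have h := norm_le_of_forall_abs_le fun i => (hx i).le
  rwa [norm_smul, norm_inv, Real.norm_of_nonneg hs.le, inv_mul_le_iff₀ hs] at h

end Grid

/-! ### Weak* convergence to the identity -/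

/-- Rapidly oscillating sums of copies of a function of mean zero converge weakly* to zero: for a
continuous test function of compact support each cell contributes at most the oscillation of
the test function on that cell, and these functions are dense in `L¹`. -/
theorem tendsto_integral_mul_tile {n : ℕ} {x₀ : Pt n} {ρ R : ℝ} (hρ : 0 < ρ) (hR : 0 < R)
    {q : Pt n → ℝ} (hq : Continuous q) (hqc : HasCompactSupport q) (hqR : ∀ y ∉ cube n R, q y = 0)
    (hq0 : ∫ y, q y = 0) {g : Pt n → ℝ} (hg : Integrable g) :
    Tendsto (fun h : ℕ => ∫ x, g x * tile (gridCenter x₀ ρ (h + 1)) (gridScale ρ R (h + 1)) q x)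
      atTop (𝓝 0) := by
  have hqi : Integrable q := hq.integrable_of_hasCompactSupport hqc
  obtain ⟨M, hM⟩ := hqc.exists_bound_of_continuous hq
  have hM0 : 0 ≤ M := (norm_nonneg _).trans (hM 0)
  set A : ℝ := (ρ / R) ^ n * ∫ y, |q y| with hA
  have hA0 : 0 ≤ A := mul_nonneg (by positivity) (integral_nonneg fun _ => abs_nonneg _)
  rw [Metric.tendsto_atTop]
  intro ε hε
  obtain ⟨g', hg'c, hgg', hg'C, hg'i⟩ := hg.exists_hasCompactSupport_integral_sub_le
    (ε := ε / (2 * (M + 1))) (by positivity)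
  obtain ⟨δ, hδ, hunif⟩ := Metric.uniformContinuous_iff.1
    (hg'c.uniformContinuous_of_continuous hg'C) (ε / (2 * (A + 1))) (by positivity)
  have hsmall : ∀ᶠ h : ℕ in atTop, gridScale ρ R (h + 1) * (n * R) < δ := by
    have := (tendsto_gridScale (ρ := ρ) (R := R)).mul_const (n * R)
    rw [zero_mul] at this
    exact this.eventually (gt_mem_nhds hδ)
  obtain ⟨h0, hh0⟩ := eventually_atTop.1 hsmall
  refine ⟨h0, fun h hh => ?_⟩
  have hN : 0 < h + 1 := Nat.succ_pos h
  set s := gridScale ρ R (h + 1)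
  set c := gridCenter x₀ ρ (h + 1)
  have hs : 0 < s := gridScale_pos hρ hR hN
  have hd : DisjointCells (cube n R) c s := disjointCells_grid hρ hR hN
  have hti : Integrable (tile c s q) := integrable_tile hqi hs
  have htC : Continuous (tile c s q) := by
    unfold tile
    fun_prop
  have htM : ∀ x, ‖tile c s q x‖ ≤ M := norm_tile_le hd hqR hM
  have hmul : ∀ f : Pt n → ℝ, Integrable f → Integrable fun x => f x * tile c s q x :=
    fun f hf => hf.mul_bdd htC.aestronglyMeasurable (Eventually.of_forall htM)
  have p1 : |∫ x, (g x - g' x) * tile c s q x| ≤ ε / (2 * (M + 1)) * M := by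
    rw [← Real.norm_eq_abs]
    refine (norm_integral_le_of_norm_le ((hg.sub hg'i).norm.mul_const M)
      (Eventually.of_forall fun x => ?_)).trans ?_
    · rw [norm_mul]
      exact mul_le_mul_of_nonneg_left (htM x) (norm_nonneg _)
    · rw [integral_mul_const]
      exact mul_le_mul_of_nonneg_right hgg' hM0
  have p2 : |∫ x, g' x * tile c s q x| ≤ ε / (2 * (A + 1)) * A := by
    have e0 : ∫ x, ∑ k, g' (c k) * q (s⁻¹ • (x - c k)) = 0 := by
      rw [integral_finsetSum _ fun k _ => (integrable_comp_rescale hqi (c k) hs).const_mul _]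
      refine Finset.sum_eq_zero fun k _ => ?_
      rw [integral_const_mul, integral_comp_rescale q _ hs.le, hq0, mul_zero, mul_zero]
    have i0 : Integrable fun x => ∑ k, g' (c k) * q (s⁻¹ • (x - c k)) :=
      integrable_finsetSum _ fun k _ => (integrable_comp_rescale hqi (c k) hs).const_mul _
    have e1 : ∫ x, g' x * tile c s q x
        = ∫ x, (g' x * tile c s q x - ∑ k, g' (c k) * q (s⁻¹ • (x - c k))) := by
      rw [integral_sub (hmul g' hg'i) i0, e0, sub_zero]
    rw [e1, ← Real.norm_eq_abs]
    refine (norm_integral_le_of_norm_le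
      ((integrable_tile (c := c) hqi.abs hs).const_mul (ε / (2 * (A + 1))))
      (Eventually.of_forall fun x => ?_)).trans ?_
    · simp only [tile, Finset.mul_sum, ← Finset.sum_sub_distrib, ← sub_mul]
      refine (norm_sum_le _ _).trans (Finset.sum_le_sum fun k _ => ?_)
      rw [norm_mul, Real.norm_eq_abs (q _)]
      by_cases hk : s⁻¹ • (x - c k) ∈ cube n R
      · refine mul_le_mul_of_nonneg_right ?_ (abs_nonneg _)
        have : dist x (c k) < δ := by
          rw [dist_eq_norm]
          exact (norm_sub_gridCenter_le hρ hR hN hk).trans_lt (hh0 h hh)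
        have := hunif this
        rw [dist_eq_norm] at this
        exact this.le
      · simp [hqR _ hk]
    · rw [integral_const_mul, integral_tile hqi.abs hs, card_mul_gridScale_pow hN]
  have e2 : ∫ x, g x * tile c s q x
      = (∫ x, (g x - g' x) * tile c s q x) + ∫ x, g' x * tile c s q x := by
    rw [← integral_add (hmul (fun x => g x - g' x) (hg.sub hg'i)) (hmul g' hg'i)]
    refine integral_congr_ae (Eventually.of_forall fun x => ?_)
    ring
  have r1 : ε / (2 * (M + 1)) * M < ε / 2 := by
    rw [div_mul_eq_mul_div, div_lt_div_iff₀ (by positivity) two_pos]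
    nlinarith
  have r2 : ε / (2 * (A + 1)) * A < ε / 2 := by
    rw [div_mul_eq_mul_div, div_lt_div_iff₀ (by positivity) two_pos]
    nlinarith
  rw [Real.dist_eq, sub_zero, e2]
  linarith [abs_add_le (∫ x, (g x - g' x) * tile c s q x) (∫ x, g' x * tile c s q x)]

theorem weakStarTendsto_glued {n : ℕ} {Ω : Set (Pt n)} (hΩ : IsOpen Ω)
    (hΩb : Bornology.IsBounded Ω) {x₀ : Pt n} {ρ R : ℝ} (hρ : 0 < ρ) (hR : 0 < R)
    {v : Pt n → Pt n} (hv : ContDiff ℝ 1 v) (hvc : HasCompactSupport v)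
    (hvR : tsupport v ⊆ cube n R) {Ψ : ℕ → Pt n → Pt n} (hΨc : ∀ h, Continuous (Ψ h))
    (hΨ : ∀ h x, Ψ h x = x + gridScale ρ R (h + 1) •
      tile (gridCenter x₀ ρ (h + 1)) (gridScale ρ R (h + 1)) v x) :
    WeakStarTendsto Ω Ψ id := by
  intro g hg
  have hd : ∀ h : ℕ, DisjointCells (cube n R) (gridCenter x₀ ρ (h + 1))
    (gridScale ρ R (h + 1)) := fun h => disjointCells_grid hρ hR h.succ_pos
  have hv0 : ∀ y ∉ cube n R, v y = 0 := fun y hy =>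
    image_eq_zero_of_notMem_tsupport fun h => hy (hvR h)
  obtain ⟨M, hM⟩ := hvc.exists_bound_of_continuous hv.continuous
  have hM0 : 0 ≤ M := (norm_nonneg _).trans (hM 0)
  obtain ⟨B, hB⟩ := hΩb.exists_norm_le
  refine ⟨fun i => ?_, fun i j => ?_⟩
  · have hclose : ∀ h x, ‖Ψ h x - x‖ ≤ gridScale ρ R (h + 1) * M := by
      intro h x
      have hs := gridScale_pos hρ hR h.succ_pos
      rw [hΨ, add_sub_cancel_left, norm_smul, Real.norm_of_nonneg hs.le]
      exact mul_le_mul_of_nonneg_left (norm_tile_le (hd h) hv0 hM x) hs.le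
    have hle : ∀ h : ℕ, gridScale ρ R (h + 1) ≤ ρ / R := by
      intro h
      unfold gridScale
      gcongr
      exact div_le_self hρ.le (by exact_mod_cast h.succ_pos)
    refine tendsto_integral_of_dominated_convergence (fun x => ‖g x‖ * (B + ρ / R * M))
      (fun h => ?_) (hg.norm.mul_const _) (fun h => ?_) (Eventually.of_forall fun x => ?_)
    · exact hg.1.mul ((EuclideanSpace.proj i : Pt n →L[ℝ] ℝ).continuous.comp
        (hΨc h)).aestronglyMeasurable
    · refine ae_restrict_of_forall_mem hΩ.measurableSet fun x hx => ?_
      rw [norm_mul]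
      refine mul_le_mul_of_nonneg_left ?_ (norm_nonneg _)
      calc ‖Ψ h x i‖ ≤ ‖Ψ h x‖ := PiLp.norm_apply_le _ _
        _ = ‖x + (Ψ h x - x)‖ := by rw [add_sub_cancel]
        _ ≤ ‖x‖ + ‖Ψ h x - x‖ := norm_add_le _ _
        _ ≤ B + ρ / R * M := add_le_add (hB x hx)
          ((hclose h x).trans (mul_le_mul_of_nonneg_right (hle h) hM0))
    · have h1 : Tendsto (fun h => Ψ h x) atTop (𝓝 x) := by
        rw [tendsto_iff_norm_sub_tendsto_zero]
        have h2 := (tendsto_gridScale (ρ := ρ) (R := R)).mul_const M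
        rw [zero_mul] at h2
        exact squeeze_zero (fun _ => norm_nonneg _) (fun h => hclose h x) h2
      exact (((EuclideanSpace.proj i : Pt n →L[ℝ] ℝ).continuous.tendsto x).comp h1).const_mul (g x)
  · set q : Pt n → ℝ := fun y => entry (fderiv ℝ v y) i j with hq
    have hqC : Continuous q := (continuous_entry i j).comp (hv.continuous_fderiv one_ne_zero)
    have hq0 : ∀ y ∉ tsupport v, q y = 0 := fun y hy => by
      simp [hq, fderiv_of_notMem_tsupport (𝕜 := ℝ) hy, entry]
    have hqc : HasCompactSupport q := HasCompactSupport.intro hvc hq0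
    have hqR : ∀ y ∉ cube n R, q y = 0 := fun y hy => hq0 y fun h => hy (hvR h)
    have hqint : ∫ y, q y = 0 := by
      have := ((EuclideanSpace.proj i : Pt n →L[ℝ] ℝ).comp
        (ContinuousLinearMap.apply ℝ (Pt n) (e j))).integral_comp_comm
        (integrable_fderiv_of_hasCompactSupport hv hvc)
      rw [integral_fderiv_eq_zero hv hvc, map_zero] at this
      exact this
    have hlim := tendsto_integral_mul_tile (x₀ := x₀) hρ hR hqC hqc hqR hqint
      (hg.integrable_indicator hΩ.measurableSet)
    have key : ∀ h, ∫ x in Ω, g x * entry (fderiv ℝ (Ψ h) x) i j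
        = (∫ x in Ω, g x * entry (fderiv ℝ (id : Pt n → Pt n) x) i j)
          + ∫ x, Ω.indicator g x *
            tile (gridCenter x₀ ρ (h + 1)) (gridScale ρ R (h + 1)) q x := by
      intro h
      have hs := gridScale_pos hρ hR h.succ_pos
      obtain ⟨M', hM'⟩ := hqc.exists_bound_of_continuous hqC
      have htC : Continuous (tile (gridCenter x₀ ρ (h + 1)) (gridScale ρ R (h + 1)) q) := by
        unfold tile
        fun_prop
      have e1 : ∫ x, Ω.indicator g x *
            tile (gridCenter x₀ ρ (h + 1)) (gridScale ρ R (h + 1)) q x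
          = ∫ x in Ω, g x * tile (gridCenter x₀ ρ (h + 1)) (gridScale ρ R (h + 1)) q x := by
        rw [← integral_indicator hΩ.measurableSet]
        congr 1
        funext x
        by_cases hx : x ∈ Ω <;> simp [hx]
      rw [e1, ← integral_add]
      · refine integral_congr_ae (Eventually.of_forall fun x => ?_)
        simp only
        rw [fderiv_glued hs hv (hΨ h), fderiv_id, ← mul_add]
        congr 1
        simp [entry, tile, hq, sum_apply]
      · simp only [fderiv_id]
        exact hg.mul_const _
      · exact hg.mul_bdd htC.aestronglyMeasurable
          (Eventually.of_forall (norm_tile_le (hd h) hqR hM'))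
    simp only [key]
    simpa using hlim.const_add (∫ x in Ω, g x * entry (fderiv ℝ (id : Pt n → Pt n) x) i j)

/-! ### Left invariance -/

/-- Blow-up at `x₀`: inserting on a fine grid over a small cube around `x₀` rescaled copies of `φ`
gives inner variations tending weakly* to the identity, while the energy changes by a fixed multiple
of `∫ (W(x₀, u(x₀), F ∇φ) - W(x₀, u(x₀), F))`, up to an
error that is small relative to this multiple when the cube is small. -/
theorem leftInvariantAt_of_leftContinuousAt {n : ℕ} {G : Set (Pt n → Pt n)}
    (hG : IsInnerSemigroup G) {Ω : Set (Pt n)} (hΩ : IsOpen Ω) (hΩb : Bornology.IsBounded Ω)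
    {W : Pt n → Pt n → Mat n → ℝ}
    (hW : ContinuousOn (fun p : Pt n × Pt n × Mat n => W p.1 p.2.1 p.2.2)
      (univ ×ˢ univ ×ˢ jet G))
    {u : Pt n → Pt n} (hu : ContDiff ℝ 1 u) (huG : ∀ x, fderiv ℝ u x ∈ jet G)
    (hlc : LeftContinuousAt G Ω W u) {x₀ : Pt n} (hx₀ : x₀ ∈ Ω) :
    LeftInvariantAt G W x₀ (u x₀) (fderiv ℝ u x₀) := by
  intro E hE hEb φ hφ
  obtain ⟨hφG, hφc, hφE⟩ := hφ
  have hφC := hG.contDiff φ hφG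
  have hud : Continuous (fderiv ℝ u) := hu.continuous_fderiv one_ne_zero
  have hφd : Continuous (fderiv ℝ φ) := hφC.continuous_fderiv one_ne_zero
  set K : Set (Pt n) := tsupport (φ - id) with hK
  have hKc : IsCompact K := hφc
  have hvC := contDiff_sub_id hφC
  have hv0 : ∀ y ∉ K, (φ - id : Pt n → Pt n) y = 0 := fun y hy =>
    image_eq_zero_of_notMem_tsupport hy
  have hφK : ∀ y ∉ K, φ y = y := fun y hy => eq_self_of_notMem_tsupport hy
  have hdK : ∀ y ∉ K, fderiv ℝ φ y = ContinuousLinearMap.id ℝ (Pt n) := fun y hy =>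
    fderiv_eq_id_of_notMem_tsupport hφC hy
  -- The cube has to contain the image of the support as well, so that `φ` maps it into itself.
  obtain ⟨R, hR, hKR⟩ := exists_subset_cube
    (hKc.union (hKc.image hφC.continuous)).isBounded
  have hKQ : K ⊆ cube n R := subset_union_left.trans hKR
  have hφQ : MapsTo φ (cube n R) (cube n R) := by
    intro y hy
    by_cases h : y ∈ K
    · exact hKR (Or.inr ⟨y, h, rfl⟩)
    · rwa [hφK y h]
  set f : Pt n → Pt n → Pt n → ℝ := fun x z w =>
    W x (u z) ((fderiv ℝ u z).comp (fderiv ℝ φ w)) with hf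
  have hfC : Continuous fun p : Pt n × Pt n × Pt n => f p.1 p.2.1 p.2.2 := by
    refine hW.comp_continuous (f := fun p : Pt n × Pt n × Pt n =>
      (p.1, u p.2.1, (fderiv ℝ u p.2.1).comp (fderiv ℝ φ p.2.2))) ?_ fun p => ?_
    · exact continuous_fst.prodMk ((hu.continuous.comp (continuous_fst.comp continuous_snd)).prodMk
        ((hud.comp (continuous_fst.comp continuous_snd)).clm_comp
          (hφd.comp (continuous_snd.comp continuous_snd))))
    · exact ⟨mem_univ _, mem_univ _, jet_comp_mem hG (huG _) (fderiv_mem_jet hG hφG _)⟩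
  set f₀ : Pt n → ℝ := fun x => W x (u x) (fderiv ℝ u x) with hf₀
  have hf₀C : Continuous f₀ :=
    hW.comp_continuous (f := fun x => (x, u x, fderiv ℝ u x))
      (continuous_id.prodMk (hu.continuous.prodMk hud))
      fun x => ⟨mem_univ _, mem_univ _, huG x⟩
  set g : Pt n → ℝ := fun w => f x₀ x₀ w - f₀ x₀ with hg
  have hgC : Continuous g :=
    (hfC.comp (continuous_const.prodMk (continuous_const.prodMk continuous_id))).sub
      continuous_const
  have hg0 : ∀ y ∉ K, g y = 0 := by
    intro y hy
    simp [hg, hf, hf₀, hdK y hy]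
  have hgi : Integrable g :=
    hgC.integrable_of_hasCompactSupport (HasCompactSupport.intro hKc hg0)
  have hmain : ∫ y, g y = 0 := by
    refine eq_zero_of_forall_abs_le_mul (C := 2 * volume.real K) fun ε hε => ?_
    -- A neighbourhood of `x₀` on which freezing `(x, u(x), ∇u(x))` costs at most `ε`.
    obtain ⟨r, hr, hrΩ, hrf₀, hrf⟩ : ∃ r > 0, Metric.ball x₀ r ⊆ Ω ∧
        (∀ x ∈ Metric.ball x₀ r, |f₀ x - f₀ x₀| ≤ ε) ∧
        ∀ x ∈ Metric.ball x₀ r, ∀ z ∈ Metric.ball x₀ r, ∀ w ∈ K,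
          |f x z w - f x₀ x₀ w| ≤ ε := by
      have h1 : ∀ᶠ x in 𝓝 x₀, x ∈ Ω := hΩ.mem_nhds hx₀
      have h2 : ∀ᶠ x in 𝓝 x₀, dist (f₀ x) (f₀ x₀) < ε :=
        hf₀C.continuousAt.eventually (Metric.ball_mem_nhds _ hε)
      have h3 : ∀ᶠ p in 𝓝 (x₀, x₀), ∀ w ∈ K, dist (f p.1 p.2 w) (f x₀ x₀ w) < ε := by
        refine hKc.eventually_forall_of_forall_eventually fun w _ => ?_
        have hc : Continuous fun z : (Pt n × Pt n) × Pt n =>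
            dist (f z.1.1 z.1.2 z.2) (f x₀ x₀ z.2) :=
          (hfC.comp ((continuous_fst.comp continuous_fst).prodMk
            ((continuous_snd.comp continuous_fst).prodMk continuous_snd))).dist
            (hfC.comp (continuous_const.prodMk (continuous_const.prodMk continuous_snd)))
        refine hc.continuousAt.eventually (gt_mem_nhds ?_)
        simpa using hε
      rw [nhds_prod_eq] at h3
      obtain ⟨p, hp, p', hp', hpp⟩ := Filter.eventually_prod_iff.1 h3
      obtain ⟨r, hr, h⟩ := Metric.eventually_nhds_iff_ball.1 (h1.and (h2.and (hp.and hp')))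
      refine ⟨r, hr, fun x hx => (h x hx).1, fun x hx => (h x hx).2.1.le,
        fun x hx z hz w hw => (hpp (h x hx).2.2.1 (h z hz).2.2.2 w hw).le⟩
    set ρ : ℝ := r / (n + 1) with hρ'
    have hρ : 0 < ρ := by positivity
    have hnρ : n * ρ < r := by
      rw [hρ', ← mul_div_assoc, div_lt_iff₀ (by positivity)]
      nlinarith
    set c : ∀ h : ℕ, (Fin n → Fin (h + 1)) → Pt n := fun h => gridCenter x₀ ρ (h + 1) with hc
    set s : ℕ → ℝ := fun h => gridScale ρ R (h + 1) with hs'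
    have hs : ∀ h, 0 < s h := fun h => gridScale_pos hρ hR h.succ_pos
    have hd : ∀ h, DisjointCells (cube n R) (c h) (s h) := fun h =>
      disjointCells_grid hρ hR h.succ_pos
    have hdK' : ∀ h, DisjointCells K (c h) (s h) := fun h x k l hk hl =>
      hd h x k l (hKQ hk) (hKQ hl)
    have hball : ∀ h x k, (s h)⁻¹ • (x - c h k) ∈ cube n R → ‖x - x₀‖ ≤ n * ρ :=
      fun h x k hx => norm_sub_le_of_mem_cell hρ hR h.succ_pos hx
    have hball' : ∀ x, ‖x - x₀‖ ≤ n * ρ → x ∈ Metric.ball x₀ r := fun x hx => by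
      rw [mem_ball_iff_norm]
      exact hx.trans_lt hnρ
    choose Ψ hΨG hΨ using fun h =>
      exists_glued hG (hs h) (hd h) hφG hφQ fun y hy => hφK y fun h => hy (hKQ h)
    have hΨC : ∀ h, ContDiff ℝ 1 (Ψ h) := fun h => hG.contDiff _ (hΨG h)
    -- Outside the copies of `K` the map `Ψ h` is the identity to first order.
    have hout : ∀ h x, (∀ k, (s h)⁻¹ • (x - c h k) ∉ K) →
        Ψ h x = x ∧ fderiv ℝ (Ψ h) x = ContinuousLinearMap.id ℝ (Pt n) := by
      intro h x hx
      rw [fderiv_glued (hs h) hvC (hΨ h), hΨ, tile_eq_zero hv0 hx,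
        tile_eq_zero (fun y hy => fderiv_of_notMem_tsupport (𝕜 := ℝ) hy) hx]
      simp
    have hin : ∀ h x k, (s h)⁻¹ • (x - c h k) ∈ K →
        (s h)⁻¹ • (Ψ h x - c h k) ∈ cube n R ∧
          fderiv ℝ (Ψ h) x = fderiv ℝ φ ((s h)⁻¹ • (x - c h k)) := by
      intro h x k hx
      constructor
      · have : (s h)⁻¹ • (Ψ h x - c h k) = φ ((s h)⁻¹ • (x - c h k)) := by
          rw [hΨ, tile_eq_of_mem (hdK' h) hv0 hx, add_sub_right_comm, smul_add,
            inv_smul_smul₀ (hs h).ne', Pi.sub_apply, id, add_sub_cancel]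
        rw [this]
        exact hφQ (hKQ hx)
      · rw [fderiv_glued (hs h) hvC (hΨ h), tile_eq_of_mem (hdK' h)
          (fun y hy => fderiv_of_notMem_tsupport (𝕜 := ℝ) hy) hx, fderiv_sub_id hφC,
          add_sub_cancel]
    have hsupp : ∀ h, SuppIn (Ψ h - id) Ω := by
      intro h
      have h1 : Function.support (Ψ h - id) ⊆ Metric.closedBall x₀ (n * ρ) := by
        intro x hx
        by_contra hxb
        refine hx ?_
        rw [Pi.sub_apply, (hout h x fun k hk => hxb ?_).1, id, sub_self]
        rw [mem_closedBall_iff_norm]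
        exact hball h x k (hKQ hk)
      have h2 := closure_minimal h1 Metric.isClosed_closedBall
      exact ⟨(isCompact_closedBall x₀ (n * ρ)).of_isClosed_subset (isClosed_tsupport _) h2,
        h2.trans ((Metric.closedBall_subset_ball hnρ).trans hrΩ)⟩
    have hweak : WeakStarTendsto Ω Ψ id :=
      weakStarTendsto_glued hΩ hΩb hρ hR hvC hφc hKQ (fun h => (hΨC h).continuous) hΨ
    have hlim := hlc Ψ (fun h => ⟨hΨG h, hsupp h⟩) hweak
    set κ : ℝ := (ρ / R) ^ n
    have hκ : 0 < κ := by positivity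
    set χ : Pt n → ℝ := K.indicator 1 with hχ
    have hχi : Integrable χ :=
      (integrable_indicator_iff hKc.measurableSet).2 (integrableOn_const hKc.measure_lt_top.ne)
    have hχ0 : ∀ y ∉ K, χ y = 0 := fun y hy => indicator_of_notMem hy _
    have hχint : ∫ y, χ y = volume.real K := integral_indicator_one hKc.measurableSet
    have hest : ∀ h, |energy W Ω (u ∘ Ψ h) - energy W Ω u - κ * ∫ y, g y|
        ≤ 2 * ε * (κ * volume.real K) := by
      intro h
      have hder : ∀ x, fderiv ℝ (u ∘ Ψ h) x = (fderiv ℝ u (Ψ h x)).comp (fderiv ℝ (Ψ h) x) :=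
        fun x => fderiv_comp x (hu.differentiable one_ne_zero _)
          ((hΨC h).differentiable one_ne_zero x)
      set w : Pt n → ℝ := fun x => W x ((u ∘ Ψ h) x) (fderiv ℝ (u ∘ Ψ h) x) with hw
      have hwC : Continuous w :=
        hW.comp_continuous (f := fun x => (x, (u ∘ Ψ h) x, fderiv ℝ (u ∘ Ψ h) x))
          (continuous_id.prodMk ((hu.continuous.comp (hΨC h).continuous).prodMk
            ((hu.comp (hΨC h)).continuous_fderiv one_ne_zero)))
          fun x => ⟨mem_univ _, mem_univ _, by
            rw [hder]
            exact jet_comp_mem hG (huG _) (fderiv_mem_jet hG (hΨG h) x)⟩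
      have hpt : ∀ x, ‖w x - f₀ x - tile (c h) (s h) g x‖ ≤ 2 * ε * tile (c h) (s h) χ x := by
        intro x
        by_cases hx : ∃ k, (s h)⁻¹ • (x - c h k) ∈ K
        · obtain ⟨k, hk⟩ := hx
          have hxb := hball' x (hball h x k (hKQ hk))
          have hΨb := hball' _ (hball h _ k (hin h x k hk).1)
          have hwx : w x = f x (Ψ h x) ((s h)⁻¹ • (x - c h k)) := by
            simp only [hw, hf, hder, (hin h x k hk).2, Function.comp_apply]
          rw [tile_eq_of_mem (hdK' h) hg0 hk, tile_eq_of_mem (hdK' h) hχ0 hk, hχ,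
            indicator_of_mem hk, Pi.one_apply, mul_one, Real.norm_eq_abs, hwx]
          have a1 := hrf x hxb _ hΨb _ hk
          have a2 := hrf₀ x hxb
          rw [abs_le] at a1 a2 ⊢
          simp only [hg]
          constructor <;> linarith
        · push Not at hx
          rw [tile_eq_zero hg0 hx, tile_eq_zero hχ0 hx]
          simp [hw, hf₀, hder, (hout h x hx).1, (hout h x hx).2]
      have k1 := integrableOn_of_continuous hΩb hwC
      have k2 := integrableOn_of_continuous hΩb hf₀C
      have k3 : IntegrableOn (tile (c h) (s h) g) Ω := (integrable_tile hgi (hs h)).integrableOn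
      have k12 : IntegrableOn (fun x => w x - f₀ x) Ω := k1.sub k2
      have hoff : ∀ q : Pt n → ℝ, (∀ y ∉ K, q y = 0) → Integrable q →
          ∫ x in Ω, tile (c h) (s h) q x = κ * ∫ y, q y := by
        intro q hq hqi
        rw [setIntegral_eq_integral_of_forall_compl_eq_zero, integral_tile hqi (hs h),
          card_mul_gridScale_pow h.succ_pos]
        intro x hx
        exact tile_eq_zero hq fun k hk => hx (hrΩ (hball' x (hball h x k (hKQ hk))))
      have hle := norm_integral_le_of_norm_le (μ := volume.restrict Ω)
        ((integrable_tile (c := c h) hχi (hs h)).integrableOn.const_mul (2 * ε))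
        (Eventually.of_forall hpt)
      rw [integral_sub k12 k3, integral_sub k1 k2, integral_const_mul, hoff g hg0 hgi,
        hoff χ hχ0 hχi, hχint] at hle
      exact hle
    have hlim2 : Tendsto (fun h => |energy W Ω (u ∘ Ψ h) - energy W Ω u - κ * ∫ y, g y|) atTop
        (𝓝 |energy W Ω u - energy W Ω u - κ * ∫ y, g y|) :=
      ((hlim.sub_const _).sub_const _).abs
    have hfinal := le_of_tendsto hlim2 (Eventually.of_forall hest)
    rw [sub_self, zero_sub, abs_neg, abs_mul, abs_of_pos hκ] at hfinal
    refine le_of_mul_le_mul_left ?_ hκ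
    linarith
  have hfin : volume E < ⊤ := hEb.measure_lt_top
  have hEg : ∫ y in E, g y = 0 := by
    rw [setIntegral_eq_integral_of_forall_compl_eq_zero, hmain]
    exact fun y hy => hg0 y fun h => hy (hφE h)
  have hsplit : ∀ y, W x₀ (u x₀) ((fderiv ℝ u x₀).comp (fderiv ℝ φ y)) = g y + f₀ x₀ := by
    intro y
    simp [hg, hf]
  simp only [hsplit]
  rw [integral_add hgi.integrableOn (integrableOn_const hfin.ne), hEg, setIntegral_const,
    smul_eq_mul, zero_add]

theorem isLeftNullLagrangian_of_leftContinuousAt {n : ℕ} {G : Set (Pt n → Pt n)}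
    (hG : IsInnerSemigroup G) {Ω : Set (Pt n)} (hΩ : IsOpen Ω) (hΩb : Bornology.IsBounded Ω)
    {W : Mat n → ℝ} (hW : ContinuousOn W (jet G))
    (hlc : ∀ ψ ∈ G, LeftContinuousAt G Ω (homogeneous W) ψ) : IsLeftNullLagrangian G Ω W := by
  intro F hF φ hφ
  rw [energy_homogeneous_comp W F (hG.contDiff φ hφ.1), energy_homogeneous_linear]
  rcases Ω.eq_empty_or_nonempty with rfl | ⟨x, hx⟩
  · simp
  rw [← jetAt_eq hG x] at hF
  obtain ⟨ψ, hψ, rfl⟩ := hF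
  have h := leftInvariantAt_of_leftContinuousAt hG hΩ hΩb (W := homogeneous W)
    (hW.comp (continuous_snd.comp continuous_snd).continuousOn fun p hp => hp.2.2)
    (hG.contDiff ψ hψ) (fun y => fderiv_mem_jet hG hψ y) (hlc ψ hψ) hx Ω hΩ hΩb φ hφ
  simpa [homogeneous] using h

end InnerVariation

theorem theorem5p2 (n : ℕ) (G : Set (Pt n → Pt n)) (hG : IsInnerSemigroup G)
    (Ω : Set (Pt n)) (hΩ : IsOpen Ω) (hΩb : Bornology.IsBounded Ω) :
    -- (i), homogeneous integrands
    (∀ W : Mat n → ℝ, ContinuousOn W (jet G) →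
      (∀ ψ ∈ G, LeftContinuousAt G Ω (homogeneous W) ψ) → IsLeftNullLagrangian G Ω W) ∧
    -- (i), integrands depending on `(x, y, F)`, with `(x, y)` frozen in the conclusion
    (∀ W : Pt n → Pt n → Mat n → ℝ,
      ContinuousOn (fun p : Pt n × Pt n × Mat n => W p.1 p.2.1 p.2.2) (univ ×ˢ univ ×ˢ jet G) →
      ∀ u : Pt n → Pt n, ContDiff ℝ 1 u → (∀ x, fderiv ℝ u x ∈ jet G) →
        LeftContinuousAt G Ω W u →
        ∀ x ∈ Ω, LeftInvariantAt G W x (u x) (fderiv ℝ u x)) ∧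
    -- (ii)
    (∀ (U : Set (Mat n)) (W : Mat n → ℝ), IsOpen U → jet G ⊆ U → ContDiffOn ℝ 2 W U →
      IsLeftNullLagrangian G Ω W →
      ∀ F ∈ jet G, ∀ η ∈ tangent G Ω,
        ∑ i, ∑ j, ∑ m, ∑ r, ∑ k, ∑ p,
          secondPartial W F i j m r * entry F i k * entry F m p *
            ∫ x in Ω, entry (fderiv ℝ η x) k j * entry (fderiv ℝ η x) p r = 0) := by
  refine ⟨fun W hW hlc => isLeftNullLagrangian_of_leftContinuousAt hG hΩ hΩb hW hlc,
    fun W hW u hu huG hlc x hx => leftInvariantAt_of_leftContinuousAt hG hΩ hΩb hW hu huG hlc hx,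
    fun U W hU hGU hW hnull F hF η hη => legendre_hadamard hG hΩb hU hGU hW hnull hF hη⟩
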